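/- A continuum is a nonempty compact connected metrizable space; it is regular if it has a base all of whose elements have finite boundary. A topological space $X$ is $n$-strongly arc connected ($n$-sac) if for any distinct $x_1,\dots,x_n\in X$ there are an arc (a topological embedding) $\alpha:[0,1]\to X$ and $t_1<\dots<t_n$ in $[0,1]$ with $\alpha(t_i)=x_i$ for all $i$. For $N\ge 3$ let $v_1,\dots,v_{N-1}$ be the standard unit vectors of $\mathbb R^{N-1}$ and $v_N=\mathbf 0$. Let $\mathcal T_0$ consist of the simplex with vertices $v_1,\dots,v_N$, and let $\mathcal T_{m+1}$ consist of all simplices with vertices $w_i$ and $\tfrac12(w_i+w_j)$ $(j\neq i)$, where $1\le i\le N$ and $w_1,\dots,w_N$ are the vertices of a simplex in $\mathcal T_m$. The $N$-trix is $T^N=\bigcap_{m\ge 0}\bigcup\mathcal T_m$. Theorem. For every $n\ge 2$ there exists a regular continuum $Z$ that is $n$-sac but not $(n+1)$-sac. Moreover, $Z$ can be taken of the following form: there are $N\ge 3$ such that the $N$-trix $T^N$ is $(2n-1)$-sac, distinct points $a_1,\dots,a_{n-1}$ of $T^N$, and distinct points $b_1,\dots,b_{n-1}$ of $T^N$, such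 that $Z$ is the quotient space of the disjoint union of two copies of $T^N$ obtained by identifying $a_i$ in the first copy with $b_i$ in the second copy, for $i=1,\dots,n-1$. -/

import Mathlib

/-- `X` is `n`-strongly arc connected: for any `n` distinct points of `X` there is an arc
(a topological embedding of `[0,1]`) visiting them in the given order. -/
def IsSac (n : ℕ) (X : Type*) [TopologicalSpace X] : Prop :=
  ∀ x : Fin n → X, Function.Injective x →
    ∃ α : unitInterval → X, Topology.IsEmbedding α ∧
      ∃ t : Fin n → unitInterval, StrictMono t ∧ ∀ i, α (t i) = x i

/-- A regular continuum: a nonempty compact connected metrizable space having a base all of whose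
elements have finite boundary. -/
structure IsRegularContinuum (X : Type*) [TopologicalSpace X] : Prop where
  compact : CompactSpace X
  connected : ConnectedSpace X
  metrizable : TopologicalSpace.MetrizableSpace X
  regular : ∃ B : Set (Set X), TopologicalSpace.IsTopologicalBasis B ∧
    ∀ U ∈ B, (frontier U).Finite

/-- The subdivision operation on a simplex given by its family of vertices `w`: it returns the
simplices with vertices `w i` and the midpoints of `w i` and `w j` for `j ≠ i`, one for each `i`
(the midpoint of `w i` and `w i` is `w i`). -/
def trixSubdivide {N : ℕ} {E : Type*} [AddCommGroup E] [Module ℝ E] (w : Fin N → E) :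
    Set (Fin N → E) :=
  Set.range fun i j => midpoint ℝ (w i) (w j)

/-- The set of simplices (given by their vertices) obtained from `v` after `m` subdivisions. -/
def trixSimplices {N : ℕ} {E : Type*} [AddCommGroup E] [Module ℝ E] (v : Fin N → E) :
    ℕ → Set (Fin N → E)
  | 0 => {v}
  | m + 1 => ⋃ w ∈ trixSimplices v m, trixSubdivide w

/-- The union of the simplices of level `m`. -/
def trixLevel {N : ℕ} {E : Type*} [AddCommGroup E] [Module ℝ E] (v : Fin N → E) (m : ℕ) :
    Set E :=
  ⋃ w ∈ trixSimplices v m, convexHull ℝ (Set.range w)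

/-- The `N` affinely independent points of `ℝ^(N-1)` consisting of the `N - 1` standard unit
coordinate vectors and, for the last index, the origin. -/
noncomputable def trixVertex (N : ℕ) (i : Fin N) : EuclideanSpace ℝ (Fin (N - 1)) :=
  WithLp.toLp 2 fun j => if (i : ℕ) = (j : ℕ) then 1 else 0

/-- The `N`-trix. -/
def NTrix (N : ℕ) : Set (EuclideanSpace ℝ (Fin (N - 1))) :=
  ⋂ m, trixLevel (trixVertex N) m

/-- The quotient space of the disjoint sum `X ⊕ Y` obtained by identifying `a i` in `X` with
`b i` in `Y`, for each `i`. -/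
abbrev Gluing {k : ℕ} {X Y : Type*} (a : Fin k ↪ X) (b : Fin k ↪ Y) : Type _ :=
  Quot fun p q : X ⊕ Y => ∃ i, p = Sum.inl (a i) ∧ q = Sum.inr (b i)

/-!
Barycentric coordinates identify the `N`-trix with the set of points `∑ j, 2⁻¹ ^ (j + 1) • v (c j)`
for all sequences `c` of letters in `Fin N`, the addresses (`iInter_trixLevel_eq`). If the dyadic
interval `[2⁻¹ ^ (j + 1), 2⁻¹ ^ j]` carries the letter `c j`, then the coordinates of the point are
the measures of the letters in `[0, 1]`. Overwriting `[0, t]` by a fixed letter `d` gives, as `t`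
runs from `0` to `1`, an arc in the trix from the point to the vertex `d` (`joinedByArc_ray`).
Comparing measures of single letters shows that two such rays, from different points to different
vertices, are disjoint as soon as these vertices are not among the letters at the first place where
the addresses differ (`ray_ne_ray`), and that a ray meets the edges of the simplex only in its final
vertex if the first letter of its address is not a vertex of the edge (`ray_eq_edge`). Hence, for
`N` of quadratic size in `q`, each of `q` given points can be given two private vertices. The arc
through the points in the given order leaves each point along a ray to its first private vertex,
runs along an edge to the second private vertex of the next point, and follows the ray of that point
backwards (`isSac_addressSet`). The trix is rim-finite, because two cells of the same level
meet in points whose addresses are eventually constant (`isRimFinite_addressSet`).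

Two copies of the trix are then glued at `n - 1` points. An arc that alternates between the two
copies `n` times needs `n` glued points, so the gluing is not `(n + 1)`-strongly arc connected
(`not_isSac_of_union`). For `n` points there are enough glued points to insert a private one
wherever consecutive points lie in different copies, and the other glued points are appended at the
end of the list. In each copy an arc runs through the at most `2 * n - 1` points of the list that
lie there. Since the list contains all glued points, the pieces of these arcs between consecutive
points of the list fit together to an arc (`isSac_of_union`).
-/

open Set Topology

/-! ### Arcs and chains of arcs -/

/-- `S` is an arc in `X` with initial point `x` and terminal point `y`. The parametrization is a
function on `ℝ`, of which only the restriction to `[0, 1]` matters. -/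
def JoinedByArc {X : Type*} [TopologicalSpace X] (x y : X) (S : Set X) : Prop :=
  ∃ f : ℝ → X, ContinuousOn f (Icc 0 1) ∧ InjOn f (Icc 0 1) ∧ f 0 = x ∧ f 1 = y ∧
    f '' Icc 0 1 = S

namespace JoinedByArc

variable {X Y : Type*} [TopologicalSpace X] [TopologicalSpace Y] {x y z : X} {S T : Set X}

/-- The arc may be parametrized by any nondegenerate compact interval. -/
theorem exists_param (h : JoinedByArc x y S) {a b : ℝ} (hab : a < b) :
    ∃ f : ℝ → X, ContinuousOn f (Icc a b) ∧ InjOn f (Icc a b) ∧ f a = x ∧ f b = y ∧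
      f '' Icc a b = S := by
  obtain ⟨f, hc, hi, h0, h1, hS⟩ := h
  have hpos : 0 < b - a := sub_pos.2 hab
  have hmaps : MapsTo (fun s => (s - a) / (b - a)) (Icc a b) (Icc 0 1) := fun s hs =>
    ⟨div_nonneg (by linarith [hs.1]) hpos.le, (div_le_one hpos).2 (by linarith [hs.2])⟩
  refine ⟨fun s => f ((s - a) / (b - a)), hc.comp (by fun_prop) hmaps, ?_, by simpa using h0, ?_,
    ?_⟩
  · intro s hs t ht hst
    have := hi (hmaps hs) (hmaps ht) hst
    field_simp at this
    linarith
  · simpa [div_self hpos.ne'] using h1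
  · rw [← hS]
    apply Subset.antisymm
    · rintro _ ⟨s, hs, rfl⟩
      exact ⟨_, hmaps hs, rfl⟩
    · rintro _ ⟨s, hs, rfl⟩
      refine ⟨a + s * (b - a), ⟨by nlinarith [hs.1], by nlinarith [hs.2]⟩, ?_⟩
      dsimp only
      congr 1
      field_simp
      ring

theorem of_param {a b : ℝ} (hab : a < b) {f : ℝ → X} (hc : ContinuousOn f (Icc a b))
    (hi : InjOn f (Icc a b)) : JoinedByArc (f a) (f b) (f '' Icc a b) := by
  have hpos : 0 < b - a := sub_pos.2 hab
  have hmaps : MapsTo (fun s => a + s * (b - a)) (Icc 0 1) (Icc a b) := fun s hs =>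
    ⟨by nlinarith [hs.1], by nlinarith [hs.2]⟩
  refine ⟨fun s => f (a + s * (b - a)), hc.comp (by fun_prop) hmaps, ?_, by simp, by simp, ?_⟩
  · intro s hs t ht hst
    have := hi (hmaps hs) (hmaps ht) hst
    have h2 : s * (b - a) = t * (b - a) := by linarith
    exact mul_right_cancel₀ hpos.ne' h2
  · apply Subset.antisymm
    · rintro _ ⟨s, hs, rfl⟩
      exact ⟨_, hmaps hs, rfl⟩
    · rintro _ ⟨s, hs, rfl⟩
      refine ⟨(s - a) / (b - a), ⟨div_nonneg (by linarith [hs.1]) hpos.le,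
        (div_le_one hpos).2 (by linarith [hs.2])⟩, ?_⟩
      dsimp only
      congr 1
      field_simp
      ring

theorem symm (h : JoinedByArc x y S) : JoinedByArc y x S := by
  obtain ⟨f, hc, hi, h0, h1, hS⟩ := h
  have hmaps : MapsTo (fun s : ℝ => 1 - s) (Icc 0 1) (Icc 0 1) := fun s hs =>
    ⟨by linarith [hs.2], by linarith [hs.1]⟩
  refine ⟨fun s => f (1 - s), hc.comp (by fun_prop) hmaps, ?_, by simpa, by simpa, ?_⟩
  · intro s hs t ht hst
    have := hi (hmaps hs) (hmaps ht) hst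
    linarith
  · rw [← hS]
    apply Subset.antisymm
    · rintro _ ⟨s, hs, rfl⟩
      exact ⟨_, hmaps hs, rfl⟩
    · rintro _ ⟨s, hs, rfl⟩
      exact ⟨1 - s, hmaps hs, by simp⟩

theorem map (h : JoinedByArc x y S) {φ : X → Y} (hφ : Continuous φ) (hφi : Function.Injective φ) :
    JoinedByArc (φ x) (φ y) (φ '' S) := by
  obtain ⟨f, hc, hi, h0, h1, hS⟩ := h
  exact ⟨φ ∘ f, hφ.comp_continuousOn hc, fun s hs t ht hst => hi hs ht (hφi hst), by simp [h0],
    by simp [h1], by rw [image_comp, hS]⟩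

theorem preimage {φ : X → Y} (hφ : IsEmbedding φ) {T : Set Y} (hT : T ⊆ range φ)
    (h : JoinedByArc (φ x) (φ y) T) : JoinedByArc x y (φ ⁻¹' T) := by
  obtain ⟨f, hc, hi, h0, h1, rfl⟩ := h
  have : Nonempty X := ⟨x⟩
  have hinv : ∀ s ∈ Icc (0 : ℝ) 1, φ (Function.invFun φ (f s)) = f s := fun s hs =>
    Function.invFun_eq (hT (mem_image_of_mem f hs))
  refine ⟨fun s => Function.invFun φ (f s), ?_, ?_, ?_, ?_, ?_⟩
  · exact hφ.isInducing.continuousOn_iff.2 (hc.congr hinv)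
  · intro s hs t ht hst
    refine hi hs ht ?_
    rw [← hinv s hs, ← hinv t ht]
    exact congrArg φ hst
  · simp [h0, Function.leftInverse_invFun hφ.injective x]
  · simp [h1, Function.leftInverse_invFun hφ.injective y]
  · ext p
    constructor
    · rintro ⟨s, hs, rfl⟩
      exact ⟨s, hs, (hinv s hs).symm⟩
    · rintro ⟨s, hs, hsp⟩
      exact ⟨s, hs, hφ.injective (by rw [hinv s hs, hsp])⟩

end JoinedByArc

section Chain

variable {X : Type*} [TopologicalSpace X]

/-- A chain of arcs, any two of which meet at most in the common end point of consecutive ones,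
can be parametrized as a single arc, whose `i`-th node is at time `i`. -/
theorem exists_param_of_chain {m : ℕ} {x : ℕ → X} {S : ℕ → Set X}
    (hS : ∀ i < m, JoinedByArc (x i) (x (i + 1)) (S i))
    (hdisj : ∀ i j, i < j → j < m → S i ∩ S j ⊆ {x (i + 1)} ∩ {x j})
    (hx : InjOn x (Iic m)) :
    ∃ f : ℝ → X, ContinuousOn f (Icc 0 m) ∧ InjOn f (Icc 0 m) ∧ (∀ i : ℕ, i ≤ m → f i = x i) ∧
      ∀ i : ℕ, i < m → f '' Icc (i : ℝ) (i + 1) = S i := by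
  have key : ∀ i : ℕ, ∃ F : ℝ → X, F i = x i ∧ (i < m → ContinuousOn F (Icc (i : ℝ) (i + 1)) ∧
      InjOn F (Icc (i : ℝ) (i + 1)) ∧ F (i + 1) = x (i + 1) ∧
      F '' Icc (i : ℝ) (i + 1) = S i) := by
    intro i
    by_cases hi : i < m
    · obtain ⟨F, h1, h2, h3, h4, h5⟩ :=
        (hS i hi).exists_param (a := (i : ℝ)) (b := i + 1) (by linarith)
      exact ⟨F, h3, fun _ => ⟨h1, h2, h4, h5⟩⟩
    · exact ⟨fun _ => x i, rfl, fun h => absurd h hi⟩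
  choose F hF0 hF using key
  let f : ℝ → X := fun s => F ⌊s⌋₊ s
  have hnode : ∀ i : ℕ, f i = x i := fun i => by simp [f, hF0]
  have hf : ∀ i : ℕ, i < m → EqOn f (F i) (Icc (i : ℝ) (i + 1)) := by
    intro i hi s hs
    rcases hs.2.lt_or_eq with h | h
    · have : ⌊s⌋₊ = i := (Nat.floor_eq_iff (i.cast_nonneg.trans hs.1)).2 ⟨hs.1, h⟩
      simp [f, this]
    · rw [h, (hF i hi).2.2.1, ← hnode (i + 1)]
      push_cast
      rfl
  have himg : ∀ i : ℕ, i < m → f '' Icc (i : ℝ) (i + 1) = S i := fun i hi => by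
    rw [(hf i hi).image_eq, (hF i hi).2.2.2]
  have hinj : ∀ i : ℕ, i < m → InjOn f (Icc (i : ℝ) (i + 1)) := fun i hi =>
    (hF i hi).2.1.congr (hf i hi).symm
  have hcont : ∀ k ≤ m, ContinuousOn f (Icc 0 (k : ℝ)) := by
    intro k
    induction k with
    | zero => intro _; simp
    | succ k ih =>
      intro hk
      have := (ih (by lia)).union_of_isClosed
        (((hF k (by lia)).1).congr (hf k (by lia))) isClosed_Icc isClosed_Icc
      rw [Icc_union_Icc_eq_Icc (Nat.cast_nonneg _) (by linarith)] at this
      exact_mod_cast this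
  -- Every parameter lies in one of the unit intervals.
  have hcell : ∀ s ∈ Icc (0 : ℝ) m, 0 < m → ∃ i : ℕ, i < m ∧ s ∈ Icc (i : ℝ) (i + 1) := by
    intro s hs hm
    rcases hs.2.lt_or_eq with h | h
    · exact ⟨⌊s⌋₊, (Nat.floor_lt hs.1).2 h, Nat.floor_le hs.1, (Nat.lt_floor_add_one s).le⟩
    · obtain ⟨k, rfl⟩ : ∃ k, m = k + 1 := ⟨m - 1, by lia⟩
      exact ⟨k, by lia, by rw [h]; push_cast; constructor <;> linarith⟩
  refine ⟨f, hcont m le_rfl, ?_, fun i _ => hnode i, himg⟩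
  have main : ∀ (i j : ℕ) (s t : ℝ), i < j → j < m → s ∈ Icc (i : ℝ) (i + 1) →
      t ∈ Icc (j : ℝ) (j + 1) → f s = f t → s = t := by
    intro i j s t hij hj hs ht hst
    have hmem : f s ∈ S i ∩ S j := ⟨himg i (hij.trans hj) ▸ mem_image_of_mem f hs,
      hst ▸ himg j hj ▸ mem_image_of_mem f ht⟩
    obtain ⟨h1, h2⟩ := hdisj i j hij hj hmem
    simp only [mem_singleton_iff] at h1 h2
    have h3 : i + 1 = j := hx (by simp; lia) (by simp; lia) (h1.symm.trans h2)
    have h4 : s = i + 1 := hinj i (by lia) hs ⟨by linarith, le_rfl⟩ (by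
      rw [h1, ← hnode (i + 1)]; push_cast; rfl)
    have h5 : t = j := hinj j hj ht ⟨le_rfl, by linarith⟩ (by rw [← hst, h2, hnode])
    rw [h4, h5, ← h3]
    push_cast
    rfl
  intro s hs t ht hst
  rcases Nat.eq_zero_or_pos m with rfl | hm
  · simp only [Nat.cast_zero, Icc_self, mem_singleton_iff] at hs ht
    rw [hs, ht]
  obtain ⟨i, hi, hsi⟩ := hcell s hs hm
  obtain ⟨j, hj, htj⟩ := hcell t ht hm
  rcases lt_trichotomy i j with h | rfl | h
  · exact main i j s t h hj hsi htj hst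
  · exact hinj i hi hsi htj hst
  · exact (main j i t s h hi htj hsi hst.symm).symm

/-- Two arcs that meet exactly in a common end point form an arc. -/
theorem JoinedByArc.trans {x y z : X} {S T : Set X} (h₁ : JoinedByArc x y S)
    (h₂ : JoinedByArc y z T) (h : S ∩ T ⊆ {y}) : JoinedByArc x z (S ∪ T) := by
  have ends : ∀ {x y : X} {S : Set X}, JoinedByArc x y S → x ∈ S ∧ y ∈ S ∧ x ≠ y := by
    rintro x y S ⟨f, -, hi, rfl, rfl, rfl⟩
    refine ⟨mem_image_of_mem f (by simp), mem_image_of_mem f (by simp), fun h => ?_⟩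
    exact zero_ne_one (hi (by simp) (by simp) h)
  obtain ⟨hx, -, hxy⟩ := ends h₁
  obtain ⟨-, hz, hyz⟩ := ends h₂
  have hxz : x ≠ z := by
    rintro rfl
    exact hxy (h ⟨hx, hz⟩)
  obtain ⟨f, hc, hi, hn, hS⟩ := exists_param_of_chain (m := 2)
    (x := fun i => if i = 0 then x else if i = 1 then y else z)
    (S := fun i => if i = 0 then S else T)
    (by
      intro i hi
      interval_cases i
      · simpa using h₁
      · simpa using h₂)
    (by
      intro i j hij hj
      obtain ⟨rfl, rfl⟩ : i = 0 ∧ j = 1 := by lia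
      simpa using h)
    (by
      intro i hi j hj hij
      simp only [mem_Iic] at hi hj
      interval_cases i <;> interval_cases j <;> simp_all)
  have := JoinedByArc.of_param (a := 0) (b := 2) (by norm_num) (by exact_mod_cast hc)
    (by exact_mod_cast hi)
  have h0 := hn 0 (by simp)
  have h2 := hn 2 (by simp)
  have hS0 := hS 0 (by simp)
  have hS1 := hS 1 (by simp)
  norm_num at h0 h2 hS0 hS1
  rw [h0, h2, ← Icc_union_Icc_eq_Icc zero_le_one one_le_two, image_union, hS0, hS1] at this
  exact this

/-- If `g` is monotone along a path `r` and determines the points of the path, then the image of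
the path is an arc, even if the path pauses. -/
theorem JoinedByArc.of_monotone [T2Space X] {r : ℝ → X} (hr : ContinuousOn r (Icc 0 1)) {g : X → ℝ}
    (hg : Continuous g)
    (hinj : ∀ s ∈ Icc (0 : ℝ) 1, ∀ t ∈ Icc (0 : ℝ) 1, g (r s) = g (r t) → r s = r t)
    (hmono : MonotoneOn (fun s => g (r s)) (Icc 0 1)) (hlt : g (r 0) < g (r 1)) :
    JoinedByArc (r 0) (r 1) (r '' Icc 0 1) := by
  set S := r '' Icc (0 : ℝ) 1 with hS
  have : CompactSpace S := isCompact_iff_compactSpace.1 (isCompact_Icc.image_of_continuousOn hr)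
  have hemb : IsClosedEmbedding (fun p : S => g p) :=
    (hg.comp continuous_subtype_val).isClosedEmbedding (by
      rintro ⟨_, s, hs, rfl⟩ ⟨_, t, ht, rfl⟩ hst
      exact Subtype.ext (hinj s hs t ht hst))
  have hrange : range (fun p : S => g p) = Icc (g (r 0)) (g (r 1)) := by
    apply Subset.antisymm
    · rintro _ ⟨⟨_, s, hs, rfl⟩, rfl⟩
      exact ⟨hmono (by simp) hs hs.1, hmono hs (by simp) hs.2⟩
    · intro u hu
      obtain ⟨s, hs, hsu⟩ := intermediate_value_Icc zero_le_one (hg.comp_continuousOn hr) hu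
      exact ⟨⟨r s, s, hs, rfl⟩, hsu⟩
  let e := hemb.isEmbedding.toHomeomorph
  let f : ℝ → X := fun u => (e.symm ⟨projIcc _ _ hlt.le u, by rw [hrange]; exact Subtype.prop _⟩ : S)
  have hfc : Continuous f := by
    refine continuous_subtype_val.comp (e.symm.continuous.comp ?_)
    exact (continuous_subtype_val.comp continuous_projIcc).subtype_mk _
  have hgf : ∀ u ∈ Icc (g (r 0)) (g (r 1)), g (f u) = u := by
    intro u hu
    have : ((e (e.symm ⟨projIcc _ _ hlt.le u, by rw [hrange]; exact Subtype.prop _⟩)) : ℝ) =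
        projIcc _ _ hlt.le u := by rw [e.apply_symm_apply]
    exact this.trans (by rw [projIcc_of_mem _ hu])
  have hfS : ∀ u, f u ∈ S := fun u => Subtype.prop _
  have hgS : ∀ p ∈ S, ∀ q ∈ S, g p = g q → p = q := by
    rintro _ ⟨s, hs, rfl⟩ _ ⟨t, ht, rfl⟩ hst
    exact hinj s hs t ht hst
  have hfg : ∀ p ∈ S, f (g p) = p := fun p hp => hgS _ (hfS _) _ hp (hgf _ (by
    rw [← hrange]; exact ⟨⟨p, hp⟩, rfl⟩))
  have := JoinedByArc.of_param hlt hfc.continuousOn (fun s hs t ht hst => by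
    rw [← hgf s hs, hst, hgf t ht])
  rw [hfg _ (mem_image_of_mem r (by simp)), hfg _ (mem_image_of_mem r (by simp))] at this
  convert this using 1
  apply Subset.antisymm
  · intro p hp
    exact ⟨g p, by rw [← hrange]; exact ⟨⟨p, hp⟩, rfl⟩, hfg p hp⟩
  · rintro _ ⟨u, -, rfl⟩
    exact hfS u

/-- A chain of arcs gives an arc through any subsequence of its nodes. -/
theorem exists_isEmbedding_of_chain [T2Space X] {m : ℕ} (hm : 0 < m) {x : ℕ → X} {S : ℕ → Set X}
    (hS : ∀ i < m, JoinedByArc (x i) (x (i + 1)) (S i))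
    (hdisj : ∀ i j, i < j → j < m → S i ∩ S j ⊆ {x (i + 1)} ∩ {x j})
    (hx : InjOn x (Iic m)) :
    ∃ α : unitInterval → X, IsEmbedding α ∧ ∃ t : Fin (m + 1) → unitInterval,
      StrictMono t ∧ ∀ i, α (t i) = x i := by
  obtain ⟨f, hc, hi, hn, -⟩ := exists_param_of_chain hS hdisj hx
  have hm' : (0 : ℝ) < m := by exact_mod_cast hm
  have hmem : ∀ s : unitInterval, (m * s : ℝ) ∈ Icc (0 : ℝ) m := fun s =>
    ⟨mul_nonneg hm'.le s.2.1, mul_le_of_le_one_right hm'.le s.2.2⟩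
  have hcont : Continuous fun s : unitInterval => f (m * s) :=
    hc.comp_continuous (by fun_prop) hmem
  refine ⟨fun s => f (m * s), (hcont.isClosedEmbedding fun s t hst => ?_).isEmbedding,
    fun i => ⟨i / m, by positivity, (div_le_one hm').2 ?_⟩, fun i j hij => ?_, fun i => ?_⟩
  · exact Subtype.ext (mul_left_cancel₀ hm'.ne' (hi (hmem s) (hmem t) hst))
  · exact_mod_cast i.is_le
  · have : (i : ℝ) < j := by exact_mod_cast hij
    exact Subtype.mk_lt_mk.2 (by gcongr)
  · dsimp only
    rw [mul_div_cancel₀ _ hm'.ne', hn i i.is_le]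

end Chain

section Sac

variable {X Y : Type*} [TopologicalSpace X] [TopologicalSpace Y]

theorem IsSac.congr {n : ℕ} (h : IsSac n X) (e : X ≃ₜ Y) : IsSac n Y := by
  intro x hx
  obtain ⟨α, hα, t, ht, htx⟩ := h (e.symm ∘ x) (e.symm.injective.comp hx)
  exact ⟨e ∘ α, e.isEmbedding.comp hα, t, ht, fun i => by simp [htx]⟩

/-- In an infinite space, further points can be appended to a given list. -/
theorem IsSac.mono [Infinite X] {m n : ℕ} (h : IsSac n X) (hmn : m ≤ n) : IsSac m X := by
  induction n, hmn using Nat.le_induction with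
  | base => exact h
  | succ k _ ih =>
    refine ih fun x hx => ?_
    obtain ⟨y, hy⟩ := (Set.finite_range x).exists_notMem
    obtain ⟨α, hα, t, ht, htx⟩ := h (Fin.snoc x y) (Fin.snoc_injective_iff.2 ⟨hx, hy⟩)
    exact ⟨α, hα, t ∘ Fin.castSucc, ht.comp (Fin.strictMono_castSucc), fun i => by simp [htx]⟩

theorem IsSac.connectedSpace [Nonempty X] (h : IsSac 2 X) : ConnectedSpace X := by
  have : PathConnectedSpace X := by
    refine ⟨inferInstance, fun x y => ?_⟩
    by_cases hxy : x = y
    · rw [hxy]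
    obtain ⟨α, hα, t, -, ht⟩ := h ![x, y] (by
      intro i j hij
      fin_cases i <;> fin_cases j <;> simp_all)
    have : PathConnectedSpace unitInterval :=
      isPathConnected_iff_pathConnectedSpace.1 ((convex_Icc 0 1).isPathConnected ⟨0, by simp⟩)
    have := (PathConnectedSpace.joined (t 0) (t 1)).map hα.continuous
    simpa [ht] using this
  infer_instance

end Sac

/-! ### Addresses and rays to the vertices -/

section Mass

/-- The length of the part of the dyadic interval `[2⁻¹ ^ (j + 1), 2⁻¹ ^ j]` to the right
of `t`. -/
noncomputable def dyadicWeight (t : ℝ) (j : ℕ) : ℝ :=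
  max (2⁻¹ ^ j) t - max (2⁻¹ ^ (j + 1)) t

theorem inv_two_pow_succ (j : ℕ) : (2⁻¹ : ℝ) ^ (j + 1) = 2⁻¹ ^ j / 2 := by
  rw [pow_succ]; ring

theorem inv_two_pow_pos (j : ℕ) : (0 : ℝ) < 2⁻¹ ^ j := by positivity

theorem dyadicWeight_zero (j : ℕ) : dyadicWeight 0 j = 2⁻¹ ^ (j + 1) := by
  rw [dyadicWeight, max_eq_left (by positivity), max_eq_left (by positivity), inv_two_pow_succ]
  ring

theorem dyadicWeight_eq_zero {t : ℝ} {j : ℕ} (h : 2⁻¹ ^ j ≤ t) : dyadicWeight t j = 0 := by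
  have := inv_two_pow_pos j
  rw [dyadicWeight, max_eq_right h, max_eq_right, sub_self]
  rw [inv_two_pow_succ]
  linarith

theorem dyadicWeight_of_le {t : ℝ} {j : ℕ} (h : t ≤ 2⁻¹ ^ (j + 1)) :
    dyadicWeight t j = 2⁻¹ ^ (j + 1) := by
  have := inv_two_pow_pos j
  rw [dyadicWeight, max_eq_left h, max_eq_left] <;> rw [inv_two_pow_succ] at * <;> linarith

theorem dyadicWeight_anti {s t : ℝ} (h : t ≤ s) (j : ℕ) : dyadicWeight s j ≤ dyadicWeight t j := by
  have h0 := inv_two_pow_pos j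
  have h1 := inv_two_pow_succ j
  unfold dyadicWeight
  rcases max_cases ((2⁻¹ : ℝ) ^ j) s with a | a <;>
  rcases max_cases ((2⁻¹ : ℝ) ^ (j + 1)) s with b | b <;>
  rcases max_cases ((2⁻¹ : ℝ) ^ j) t with c | c <;>
  rcases max_cases ((2⁻¹ : ℝ) ^ (j + 1)) t with d | d <;> linarith

theorem dyadicWeight_nonneg (t : ℝ) (j : ℕ) : 0 ≤ dyadicWeight t j := by
  refine sub_nonneg.2 (max_le_max_right _ ?_)
  have := inv_two_pow_pos j
  rw [inv_two_pow_succ]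
  linarith

theorem hasSum_dyadicWeight {t : ℝ} (h0 : 0 ≤ t) (h1 : t ≤ 1) :
    HasSum (dyadicWeight t) (1 - t) := by
  rw [hasSum_iff_tendsto_nat_of_nonneg (dyadicWeight_nonneg t)]
  have h : ∀ n, ∑ i ∈ Finset.range n, dyadicWeight t i = 1 - max (2⁻¹ ^ n) t := fun n => by
    have := Finset.sum_range_sub' (fun j => max ((2⁻¹ : ℝ) ^ j) t) n
    simpa [dyadicWeight, h1] using this
  simp_rw [h]
  have h2 : Filter.Tendsto (fun n : ℕ => (2⁻¹ : ℝ) ^ n) Filter.atTop (𝓝 0) :=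
    tendsto_pow_atTop_nhds_zero_of_lt_one (by norm_num) (by norm_num)
  have := tendsto_const_nhds (x := (1 : ℝ)).sub (h2.max (tendsto_const_nhds (x := t)))
  simpa [h0] using this

variable {ι : Type*} [DecidableEq ι]

/-- Let the dyadic interval `[2⁻¹ ^ (j + 1), 2⁻¹ ^ j]` carry the letter `c j`. Then `mass c t l` is
the measure of the part of `[t, 1]` that carries the letter `l`. -/
noncomputable def mass (c : ℕ → ι) (t : ℝ) (l : ι) : ℝ :=
  ∑' j, if c j = l then dyadicWeight t j else 0

variable {c c' : ℕ → ι} {s t : ℝ} {l a d : ι} {j : ℕ}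

theorem summable_mass (c : ℕ → ι) (l : ι) (h0 : 0 ≤ t) (h1 : t ≤ 1) :
    Summable fun j => if c j = l then dyadicWeight t j else 0 := by
  refine Summable.of_nonneg_of_le (fun j => ?_) (fun j => ?_) (hasSum_dyadicWeight h0 h1).summable
  all_goals
    have := dyadicWeight_nonneg t j
    split_ifs <;> simp [this]

theorem mass_nonneg (c : ℕ → ι) (t : ℝ) (l : ι) : 0 ≤ mass c t l :=
  tsum_nonneg fun j => by
    have := dyadicWeight_nonneg t j
    split_ifs <;> simp [this]

theorem sum_mass [Fintype ι] (c : ℕ → ι) (h0 : 0 ≤ t) (h1 : t ≤ 1) :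
    ∑ l, mass c t l = 1 - t := by
  have := hasSum_sum (s := Finset.univ) fun l _ => (summable_mass c l h0 h1).hasSum
  simp only [Finset.sum_ite_eq, Finset.mem_univ, if_true] at this
  exact this.unique (hasSum_dyadicWeight h0 h1)

theorem hasSum_mass_sub (c : ℕ → ι) (l : ι) (h0 : 0 ≤ t) (hts : t ≤ s) (h1 : s ≤ 1) :
    HasSum (fun j => if c j = l then dyadicWeight t j - dyadicWeight s j else 0)
      (mass c t l - mass c s l) := by
  convert! (summable_mass c l h0 (hts.trans h1)).hasSum.sub
    (summable_mass c l (h0.trans hts) h1).hasSum using 2 with j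
  split_ifs <;> simp

theorem mass_anti (c : ℕ → ι) (l : ι) (h0 : 0 ≤ t) (hts : t ≤ s) (h1 : s ≤ 1) :
    mass c s l ≤ mass c t l := by
  refine sub_nonneg.1 ((hasSum_mass_sub c l h0 hts h1).nonneg fun j => ?_)
  have := dyadicWeight_anti hts j
  split_ifs <;> simp [this]

theorem mass_sub_le (c : ℕ → ι) (l : ι) (h0 : 0 ≤ t) (hts : t ≤ s) (h1 : s ≤ 1) :
    mass c t l - mass c s l ≤ s - t := by
  have := (hasSum_dyadicWeight h0 (hts.trans h1)).sub (hasSum_dyadicWeight (h0.trans hts) h1)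
  refine (hasSum_le (fun j => ?_) (hasSum_mass_sub c l h0 hts h1) this).trans (by linarith)
  have := dyadicWeight_anti hts j
  split_ifs <;> simp [this]

theorem mass_sub_le_of_ne (h : c j ≠ l) (h0 : 0 ≤ t) (hts : t ≤ s) (h1 : s ≤ 1) :
    mass c t l - mass c s l ≤ s - t - (dyadicWeight t j - dyadicWeight s j) := by
  have h2 := ((hasSum_dyadicWeight h0 (hts.trans h1)).sub
    (hasSum_dyadicWeight (h0.trans hts) h1)).sub (hasSum_ite_eq j
      (dyadicWeight t j - dyadicWeight s j))
  refine (hasSum_le (fun i => ?_) (hasSum_mass_sub c l h0 hts h1) h2).trans (by linarith)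
  have := dyadicWeight_anti hts i
  by_cases hij : i = j
  · subst hij
    simp [h]
  · simp only [hij, if_false]
    split_ifs <;> simp [this]

theorem le_mass_sub (h : c j = l) (h0 : 0 ≤ t) (hts : t ≤ s) (h1 : s ≤ 1) :
    dyadicWeight t j - dyadicWeight s j ≤ mass c t l - mass c s l := by
  have := le_hasSum (hasSum_mass_sub c l h0 hts h1) j fun i _ => by
    have := dyadicWeight_anti hts i
    split_ifs <;> simp [this]
  simpa [h] using this

theorem mass_congr (h : ∀ i < j, c i = c' i) (hs : 2⁻¹ ^ j ≤ s) (l : ι) :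
    mass c s l = mass c' s l := by
  refine tsum_congr fun i => ?_
  by_cases hi : i < j
  · rw [h i hi]
  · have : (2⁻¹ : ℝ) ^ i ≤ 2⁻¹ ^ j :=
      pow_le_pow_of_le_one (by norm_num) (by norm_num) (not_lt.1 hi)
    simp [dyadicWeight_eq_zero (this.trans hs)]

theorem mass_one (c : ℕ → ι) (l : ι) : mass c 1 l = 0 := by
  refine (tsum_congr fun i => ?_).trans tsum_zero
  simp [dyadicWeight_eq_zero (pow_le_one₀ (n := i) (by norm_num : (0 : ℝ) ≤ 2⁻¹) (by norm_num))]

theorem mass_eq_sum (l : ι) (h1 : 2⁻¹ ^ (j + 1) ≤ t) (h2 : t ≤ 2⁻¹ ^ j) :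
    mass c t l = (∑ i ∈ Finset.range j, if c i = l then (2⁻¹ : ℝ) ^ (i + 1) else 0) +
      if c j = l then 2⁻¹ ^ j - t else 0 := by
  rw [mass, tsum_eq_sum (s := Finset.range (j + 1)), Finset.sum_range_succ]
  · congr 1
    · refine Finset.sum_congr rfl fun i hi => ?_
      rw [dyadicWeight_of_le (h2.trans (pow_le_pow_of_le_one (by norm_num) (by norm_num)
        (Finset.mem_range.1 hi)))]
    · rw [dyadicWeight, max_eq_left h2, max_eq_right h1]
  · intro i hi
    have : j + 1 ≤ i := by simpa using hi
    have h3 : (2⁻¹ : ℝ) ^ i ≤ 2⁻¹ ^ (j + 1) :=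
      pow_le_pow_of_le_one (by norm_num) (by norm_num) this
    simp [dyadicWeight_eq_zero (h3.trans h1)]

/-- The self-similarity of the addresses. -/
theorem mass_zero_eq_sum_add (c : ℕ → ι) (j : ℕ) (l : ι) :
    mass c 0 l = (∑ i ∈ Finset.range j, if c i = l then (2⁻¹ : ℝ) ^ (i + 1) else 0) +
      2⁻¹ ^ j * mass (fun i => c (i + j)) 0 l := by
  rw [mass, ← (summable_mass c l le_rfl zero_le_one).sum_add_tsum_nat_add j, mass, ← tsum_mul_left]
  simp_rw [dyadicWeight_zero]
  congr 1
  refine tsum_congr fun i => ?_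
  split_ifs
  · rw [← pow_add]; congr 1; ring
  · simp

/-- The edges of the simplex consist of points with addresses in two letters. -/
theorem exists_mass_eq_edge (a d : ι) {θ : ℝ} (hθ : θ ∈ Icc (0 : ℝ) 1) :
    ∃ b : ℕ → ι, ∀ l, mass b 0 l = (if a = l then 1 - θ else 0) + if d = l then θ else 0 := by
  obtain ⟨x, -, hx⟩ := Real.ofDigits_SurjOn one_lt_two hθ
  refine ⟨fun j => if x j = 0 then a else d, fun l => ?_⟩
  have h1 : HasSum (Real.ofDigitsTerm x) θ := hx ▸ Real.summable_ofDigitsTerm.hasSum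
  have h2 := (hasSum_dyadicWeight le_rfl zero_le_one).sub h1
  have h3 := (h2.mul_right (if a = l then 1 else 0)).add (h1.mul_right (if d = l then 1 else 0))
  rw [mass]
  convert! h3.tsum_eq using 1
  · refine tsum_congr fun j => ?_
    rw [dyadicWeight_zero, Real.ofDigitsTerm]
    have : x j = 0 ∨ x j = 1 := by
      have := (x j).2
      lia
    rcases this with h | h <;> by_cases hal : a = l <;> by_cases hdl : d = l <;> simp [h, hal, hdl]
  · by_cases hal : a = l <;> by_cases hdl : d = l <;> simp [hal, hdl]

/-- The ray from the point with address `c` to the vertex `d`: the point at time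
`t ≤ 2⁻¹ ^ j` lies in the cell of level `j` of `c`, and on `[2⁻¹ ^ (j + 1), 2⁻¹ ^ j]` it runs along
half an edge of this cell. -/
noncomputable def ray (c : ℕ → ι) (d : ι) (t : ℝ) : ι → ℝ :=
  fun l => mass c t l + if d = l then t else 0

variable (ι) in
/-- The points with an address, in barycentric coordinates. -/
def addressSet : Set (ι → ℝ) := range fun c : ℕ → ι => mass c 0

theorem ray_zero (c : ℕ → ι) (d : ι) : ray c d 0 = mass c 0 := by
  ext l; simp [ray]

theorem ray_one (c : ℕ → ι) (d : ι) : ray c d 1 = Pi.single d 1 := by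
  ext l
  by_cases h : d = l
  · subst h; simp [ray, mass_one]
  · simp [ray, mass_one, h, Ne.symm h]

theorem edge_mem_addressSet (a d : ι) (ht : t ∈ Icc (0 : ℝ) 1) :
    AffineMap.lineMap (Pi.single a 1 : ι → ℝ) (Pi.single d 1) t ∈ addressSet ι := by
  obtain ⟨b, hb⟩ := exists_mass_eq_edge a d ht
  refine ⟨b, ?_⟩
  ext l
  dsimp only
  rw [hb, AffineMap.lineMap_apply_module]
  simp [Pi.single_apply, eq_comm]

theorem ray_mem_addressSet (c : ℕ → ι) (d : ι) (ht : t ∈ Icc (0 : ℝ) 1) :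
    ray c d t ∈ addressSet ι := by
  rcases ht.1.eq_or_lt with rfl | h0
  · exact ⟨c, (ray_zero c d).symm⟩
  obtain ⟨j, h1, h2⟩ := exists_nat_pow_near_of_lt_one h0 ht.2 (by norm_num : (0 : ℝ) < 2⁻¹)
    (by norm_num)
  have hj := inv_two_pow_pos j
  obtain ⟨b, hb⟩ := exists_mass_eq_edge (c j) d (θ := t / 2⁻¹ ^ j)
    ⟨by positivity, (div_le_one hj).2 h2⟩
  refine ⟨fun i => if i < j then c i else b (i - j), ?_⟩
  ext l
  dsimp only
  rw [mass_zero_eq_sum_add _ j, ray, mass_eq_sum l h1.le h2]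
  simp only [add_lt_iff_neg_right, not_lt_zero, if_false, Nat.add_sub_cancel]
  rw [hb, add_assoc]
  congr 1
  · exact Finset.sum_congr rfl fun i hi => by simp [Finset.mem_range.1 hi]
  · split_ifs <;> field_simp <;> ring

theorem ray_continuousOn [Fintype ι] (c : ℕ → ι) (d : ι) : ContinuousOn (ray c d) (Icc 0 1) := by
  refine continuousOn_pi.2 fun l => ContinuousOn.add ?_ (by split_ifs <;> fun_prop)
  refine LipschitzOnWith.continuousOn (K := 1) (LipschitzOnWith.of_le_add_mul 1 ?_)
  intro s hs t ht
  rw [Real.dist_eq, NNReal.coe_one, one_mul]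
  rcases le_total s t with h | h
  · have := mass_sub_le c l hs.1 h ht.2
    rw [abs_sub_comm, abs_of_nonneg (by linarith)]
    linarith
  · have := mass_anti c l ht.1 h hs.2
    have := abs_nonneg (s - t)
    linarith

/-- A ray is an arc: its coordinate belonging to the vertex `d` never decreases, and where it is
constant, the whole ray pauses. -/
theorem joinedByArc_ray [Fintype ι] (hc : c 0 ≠ d) :
    JoinedByArc (mass c 0) (Pi.single d 1) (ray c d '' Icc 0 1) := by
  rw [← ray_zero c d, ← ray_one c d]
  have hle : ∀ s ∈ Icc (0 : ℝ) 1, ∀ t ∈ Icc (0 : ℝ) 1, s ≤ t → ray c d s d ≤ ray c d t d := by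
    intro s hs t ht h
    have := mass_sub_le c d hs.1 h ht.2
    simp only [ray, if_true]
    linarith
  have hinj : ∀ s ∈ Icc (0 : ℝ) 1, ∀ t ∈ Icc (0 : ℝ) 1, s ≤ t → ray c d s d = ray c d t d →
      ray c d s = ray c d t := by
    intro s hs t ht h heq
    have h1 := sum_mass c hs.1 hs.2
    have h2 := sum_mass c ht.1 ht.2
    rw [← Finset.add_sum_erase _ _ (Finset.mem_univ d)] at h1 h2
    simp only [ray, if_true] at heq
    have h3 : ∑ l ∈ Finset.univ.erase d, mass c t l = ∑ l ∈ Finset.univ.erase d, mass c s l := by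
      linarith
    have h4 := (Finset.sum_eq_sum_iff_of_le fun l _ => mass_anti c l hs.1 h ht.2).1 h3
    ext l
    by_cases hl : d = l
    · subst hl; simpa [ray] using heq
    · simp [ray, hl, h4 l (by simp [Ne.symm hl])]
  refine JoinedByArc.of_monotone (ray_continuousOn c d) (g := fun p => p d) (by fun_prop) ?_
    (fun s hs t ht h => hle s hs t ht h) ?_
  · intro s hs t ht h
    rcases le_total s t with hst | hst
    · exact hinj s hs t ht hst h
    · exact (hinj t ht s hs hst h.symm).symm
  · have := mass_sub_le_of_ne hc le_rfl zero_le_one le_rfl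
    rw [dyadicWeight_zero, dyadicWeight_eq_zero (by simp), mass_one] at this
    simp only [ray, if_true, mass_one]
    norm_num at this ⊢
    linarith

theorem joinedByArc_edge [Fintype ι] (h : a ≠ d) :
    JoinedByArc (Pi.single a 1) (Pi.single d 1)
      (AffineMap.lineMap (Pi.single a 1 : ι → ℝ) (Pi.single d 1) '' Icc (0 : ℝ) 1) := by
  refine ⟨AffineMap.lineMap (Pi.single a 1 : ι → ℝ) (Pi.single d 1),
    AffineMap.lineMap_continuous.continuousOn, ?_, by simp, by simp, rfl⟩
  refine (AffineMap.lineMap_injective ℝ fun hs => h ?_).injOn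
  by_contra hne
  simpa [Pi.single_apply, hne] using congrFun hs a

end Mass

/-! ### Strong arc connectedness of the set of addresses -/

section Disjointness

variable {ι : Type*} [DecidableEq ι] {c c' : ℕ → ι} {a b d e : ι} {s t : ℝ} {j : ℕ}

/-- At a common point both rays have the same coordinate at the letter `c j`, which comes from the
masses alone. If the second ray has not yet left the cell common to both addresses, this letter has
at least half of the mass of the first ray in this cell and at most the other half of that of the
second ray, which forces `s = t = 0`. -/
theorem ray_ne_ray_of_le (hagree : ∀ i < j, c i = c' i) (hne : c j ≠ c' j)
    (hcd : c j ≠ d) (hce : c j ≠ e) (hde : d ≠ e)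
    (hcc' : mass c 0 ≠ mass c' 0) (ht : 0 ≤ t) (hts : t ≤ s) (hs : s ≤ 1) :
    ray c d t ≠ ray c' e s := by
  intro h
  have hσ := inv_two_pow_pos j
  have hσ' := inv_two_pow_succ j
  have hσ1 : (2⁻¹ : ℝ) ^ j ≤ 1 := pow_le_one₀ (by norm_num) (by norm_num)
  have ha : mass c t (c j) = mass c' s (c j) := by
    simpa [ray, hcd.symm, hce.symm] using congrFun h (c j)
  -- From time `2⁻¹ ^ j` on, the masses of both addresses agree.
  rcases le_or_gt (2⁻¹ ^ j) s with hs1 | hs1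
  · have he := congrFun h e
    simp only [ray, hde, if_false, if_true, add_zero] at he
    rw [← mass_congr hagree hs1] at he ha
    have h0 : t = 0 := by linarith [mass_sub_le c e ht hts hs]
    subst h0
    have := le_mass_sub (c := c) (j := j) rfl le_rfl hts hs
    rw [dyadicWeight_zero, dyadicWeight_eq_zero hs1] at this
    linarith
  · have h1 := le_mass_sub (c := c) (j := j) rfl ht (hts.trans hs1.le) hσ1
    have h2 := mass_sub_le_of_ne hne.symm (ht.trans hts) hs1.le hσ1
    rw [mass_congr hagree le_rfl] at h1
    rw [dyadicWeight_eq_zero le_rfl] at h1 h2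
    rw [dyadicWeight, max_eq_left (hts.trans hs1.le)] at h1
    rw [dyadicWeight, max_eq_left hs1.le] at h2
    rw [ha] at h1
    have hs0 : s = 0 := by
      rcases max_cases ((2⁻¹ : ℝ) ^ (j + 1)) t with x | x <;>
      rcases max_cases ((2⁻¹ : ℝ) ^ (j + 1)) s with y | y <;> linarith
    have ht0 : t = 0 := by linarith
    subst hs0 ht0
    exact hcc' (by rwa [ray_zero, ray_zero] at h)

/-- Rays from different points to different vertices are disjoint, unless one of the vertices is
a letter at the first place where the addresses differ. -/
theorem ray_ne_ray (hagree : ∀ i < j, c i = c' i) (hne : c j ≠ c' j)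
    (hcd : c j ≠ d) (hce : c j ≠ e) (hcd' : c' j ≠ d) (hce' : c' j ≠ e) (hde : d ≠ e)
    (hcc' : mass c 0 ≠ mass c' 0) (ht : t ∈ Icc (0 : ℝ) 1) (hs : s ∈ Icc (0 : ℝ) 1) :
    ray c d t ≠ ray c' e s := by
  rcases le_total t s with h | h
  · exact ray_ne_ray_of_le hagree hne hcd hce hde hcc' ht.1 h hs.2
  · exact (ray_ne_ray_of_le (fun i hi => (hagree i hi).symm) hne.symm hce' hcd' hde.symm hcc'.symm
      hs.1 h ht.2).symm

/-- Rays from the same point to different vertices meet only in this point. -/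
theorem ray_eq_ray_self (hde : d ≠ e) (ht : t ∈ Icc (0 : ℝ) 1) (hs : s ∈ Icc (0 : ℝ) 1)
    (h : ray c d t = ray c e s) : ray c d t = mass c 0 := by
  rcases le_total t s with hts | hts
  · have he := congrFun h e
    simp only [ray, hde, if_false, if_true, add_zero] at he
    have : t = 0 := by linarith [mass_sub_le c e ht.1 hts hs.2, ht.1]
    rw [this, ray_zero]
  · have he := congrFun h d
    simp only [ray, hde.symm, if_false, if_true, add_zero] at he
    have : s = 0 := by linarith [mass_sub_le c d hs.1 hts ht.2, hs.1]
    rw [h, this, ray_zero]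

theorem edge_apply (a b : ι) (s : ℝ) (l : ι) :
    (AffineMap.lineMap (Pi.single a 1 : ι → ℝ) (Pi.single b 1) s : ι → ℝ) l =
      (if l = a then 1 - s else 0) + if l = b then s else 0 := by
  rw [AffineMap.lineMap_apply_module]
  simp [Pi.single_apply]

/-- An edge of the simplex meets a ray at most in the vertex where the ray ends. -/
theorem ray_eq_edge (hd : c 0 ≠ d) (ha : c 0 ≠ a) (hb : c 0 ≠ b) (ht : t ∈ Icc (0 : ℝ) 1)
    (h : ray c d t = AffineMap.lineMap (Pi.single a 1 : ι → ℝ) (Pi.single b 1) s) :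
    ray c d t = Pi.single d 1 := by
  have h1 := congrFun h (c 0)
  rw [edge_apply] at h1
  simp only [ray, hd.symm, ha, hb, if_false, add_zero] at h1
  have h2 := le_mass_sub (c := c) (j := 0) rfl ht.1 ht.2 le_rfl
  rw [h1, mass_one, dyadicWeight_eq_zero (t := 1) (by simp), dyadicWeight, pow_zero,
    max_eq_left ht.2] at h2
  have h3 : t = 1 := by
    refine le_antisymm ht.2 ?_
    rcases max_cases ((2⁻¹ : ℝ) ^ (0 + 1)) t with x | x <;> norm_num at x h2 <;> linarith
  rw [h3, ray_one]

end Disjointness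

section Chain

variable {ι : Type*} [Fintype ι] [DecidableEq ι]

/-- The arcs that leave each point along a ray to a private vertex, run along an edge to a private
vertex of the next point, and reach this point along a ray, form a chain. -/
theorem exists_chain_addressSet {m : ℕ} {c : ℕ → ℕ → ι} {col : ℕ → ι}
    (hcol : InjOn col (Iio (2 * m + 2)))
    (hfirst : ∀ i ≤ m, ∀ r < 2 * m + 2, c i 0 ≠ col r)
    (hinj : ∀ i ≤ m, ∀ j ≤ m, i ≠ j → mass (c i) 0 ≠ mass (c j) 0)
    (hdiff : ∀ i ≤ m, ∀ j ≤ m, i ≠ j → ∃ p, (∀ q < p, c i q = c j q) ∧ c i p ≠ c j p ∧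
      ∀ r < 2 * m + 2, c i p ≠ col r ∧ c j p ≠ col r) :
    ∃ S : ℕ → Set (ι → ℝ), (∀ i, S i ⊆ addressSet ι) ∧
      (∀ i < m, JoinedByArc (mass (c i) 0) (mass (c (i + 1)) 0) (S i)) ∧
      ∀ i j, i < j → j < m → S i ∩ S j ⊆ {mass (c (i + 1)) 0} ∩ {mass (c j) 0} := by
  let R : ℕ → ℕ → Set (ι → ℝ) := fun i r => ray (c i) (col r) '' Icc 0 1
  let E : ℕ → ℕ → Set (ι → ℝ) := fun r r' =>
    AffineMap.lineMap (Pi.single (col r) 1 : ι → ℝ) (Pi.single (col r') 1) '' Icc (0 : ℝ) 1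
  have hc : ∀ {r r'}, r < 2 * m + 2 → r' < 2 * m + 2 → r ≠ r' → col r ≠ col r' :=
    fun h h' hne heq => hne (hcol h h' heq)
  have hRR : ∀ {i i' r r'}, i ≤ m → i' ≤ m → r < 2 * m + 2 → r' < 2 * m + 2 → i ≠ i' → r ≠ r' →
      Disjoint (R i r) (R i' r') := by
    intro i i' r r' hi hi' hr hr' hne hner
    refine disjoint_left.2 ?_
    rintro _ ⟨t, ht, rfl⟩ ⟨s, hs, heq⟩
    obtain ⟨p, h1, h2, h3⟩ := hdiff i hi i' hi' hne
    exact ray_ne_ray h1 h2 (h3 r hr).1 (h3 r' hr').1 (h3 r hr).2 (h3 r' hr').2 (hc hr hr' hner)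
      (hinj i hi i' hi' hne) ht hs heq.symm
  have hRself : ∀ {i r r'}, r < 2 * m + 2 → r' < 2 * m + 2 → r ≠ r' →
      R i r ∩ R i r' ⊆ {mass (c i) 0} := by
    rintro i r r' hr hr' hne _ ⟨⟨t, ht, rfl⟩, s, hs, heq⟩
    exact ray_eq_ray_self (hc hr hr' hne) ht hs heq.symm
  have hRE : ∀ {i r a b}, i ≤ m → r < 2 * m + 2 → a < 2 * m + 2 → b < 2 * m + 2 →
      R i r ∩ E a b ⊆ {Pi.single (col r) 1} := by
    rintro i r a b hi hr ha hb _ ⟨⟨t, ht, rfl⟩, s, hs, heq⟩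
    exact ray_eq_edge (hfirst i hi r hr) (hfirst i hi a ha) (hfirst i hi b hb) ht heq.symm
  have hRE' : ∀ {i r a b}, i ≤ m → r < 2 * m + 2 → a < 2 * m + 2 → b < 2 * m + 2 → r ≠ a → r ≠ b →
      Disjoint (R i r) (E a b) := by
    intro i r a b hi hr ha hb hra hrb
    refine disjoint_left.2 fun p hp hpE => ?_
    have h1 : p = Pi.single (col r) 1 := hRE hi hr ha hb ⟨hp, hpE⟩
    obtain ⟨s, -, hs⟩ := hpE
    have h2 := congrFun (hs.trans h1) (col r)
    rw [edge_apply] at h2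
    simp [hc hr ha hra, hc hr hb hrb] at h2
  have hEE : ∀ {a b a' b'}, a < 2 * m + 2 → b < 2 * m + 2 → a' < 2 * m + 2 → b' < 2 * m + 2 →
      a ≠ a' → a ≠ b' → b ≠ a' → b ≠ b' → a ≠ b → Disjoint (E a b) (E a' b') := by
    intro a b a' b' ha hb ha' hb' h1 h2 h3 h4 h5
    refine disjoint_left.2 ?_
    rintro _ ⟨t, ht, rfl⟩ ⟨s, hs, heq⟩
    have hA := congrFun heq (col a)
    have hB := congrFun heq (col b)
    rw [edge_apply, edge_apply] at hA hB
    simp only [hc ha ha' h1, hc ha hb' h2, hc ha hb h5, if_false, if_true] at hA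
    simp only [hc hb ha' h3, hc hb hb' h4, (hc ha hb h5).symm, if_false, if_true] at hB
    linarith
  -- The vertex `col (2 * i)` is for leaving the `i`-th point, `col (2 * i + 1)` for reaching it.
  refine ⟨fun i => (R i (2 * i) ∪ E (2 * i) (2 * i + 3)) ∪ R (i + 1) (2 * i + 3), ?_, ?_, ?_⟩
  · rintro i _ ((⟨t, ht, rfl⟩ | ⟨t, ht, rfl⟩) | ⟨t, ht, rfl⟩)
    exacts [ray_mem_addressSet _ _ ht, edge_mem_addressSet _ _ ht, ray_mem_addressSet _ _ ht]
  · intro i hi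
    have h1 : JoinedByArc _ _ (R i (2 * i)) :=
      joinedByArc_ray (hfirst i hi.le (2 * i) (by lia))
    have h2 : JoinedByArc _ _ (E (2 * i) (2 * i + 3)) :=
      joinedByArc_edge (hc (by lia) (by lia) (by lia))
    have h3 : JoinedByArc _ _ (R (i + 1) (2 * i + 3)) :=
      joinedByArc_ray (hfirst (i + 1) hi (2 * i + 3) (by lia))
    refine (h1.trans h2 (hRE hi.le (by lia) (by lia) (by lia))).trans h3.symm ?_
    rw [union_inter_distrib_right, (hRR hi.le hi (by lia) (by lia) (by lia) (by lia)).inter_eq,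
      empty_union, inter_comm]
    exact hRE hi (by lia) (by lia) (by lia)
  · intro i j hij hj p hp
    obtain ⟨(h1 | h1) | h1, (h2 | h2) | h2⟩ := hp
    · exact ((hRR (by lia) (by lia) (by lia) (by lia) (by lia) (by lia)).le_bot ⟨h1, h2⟩).elim
    · exact ((hRE' (by lia) (by lia) (by lia) (by lia) (by lia) (by lia)).le_bot ⟨h1, h2⟩).elim
    · exact ((hRR (by lia) (by lia) (by lia) (by lia) (by lia) (by lia)).le_bot ⟨h1, h2⟩).elim
    · exact ((hRE' (by lia) (by lia) (by lia) (by lia) (by lia) (by lia)).le_bot ⟨h2, h1⟩).elim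
    · exact ((hEE (by lia) (by lia) (by lia) (by lia) (by lia) (by lia) (by lia) (by lia)
        (by lia)).le_bot ⟨h1, h2⟩).elim
    · exact ((hRE' (by lia) (by lia) (by lia) (by lia) (by lia) (by lia)).le_bot ⟨h2, h1⟩).elim
    · by_cases h : i + 1 = j
      · subst h
        have := hRself (by lia) (by lia) (by lia) ⟨h1, h2⟩
        exact ⟨this, this⟩
      · exact ((hRR (by lia) (by lia) (by lia) (by lia) h (by lia)).le_bot ⟨h1, h2⟩).elim
    · exact ((hRE' (by lia) (by lia) (by lia) (by lia) (by lia) (by lia)).le_bot ⟨h1, h2⟩).elim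
    · exact ((hRR (by lia) (by lia) (by lia) (by lia) (by lia) (by lia)).le_bot ⟨h1, h2⟩).elim

/-- With sufficiently many letters, there are enough vertices that are neither the first letter
of one of the points nor a letter at the first difference of two of them. -/
theorem isSac_addressSet {m : ℕ} (hm : 0 < m)
    (hcard : (m + 1) + 2 * (m + 1) ^ 2 + (2 * m + 2) ≤ Fintype.card ι) :
    IsSac (m + 1) (addressSet ι) := by
  intro x hx
  choose c hc using fun i => (x i).2
  have hcinj : ∀ i j, i ≠ j → mass (c i) 0 ≠ mass (c j) 0 := fun i j hij h =>
    hij (hx (Subtype.ext (by rw [← hc i, ← hc j]; exact h)))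
  have hp : ∀ i j, ∃ p, i ≠ j → (∀ q < p, c i q = c j q) ∧ c i p ≠ c j p := by
    intro i j
    by_cases hij : i = j
    · exact ⟨0, fun h => absurd hij h⟩
    have hne : ∃ p, c i p ≠ c j p := by
      by_contra! h
      exact hcinj i j hij (by rw [funext h])
    classical
    exact ⟨Nat.find hne, fun _ => ⟨fun q hq => not_not.1 (Nat.find_min hne hq),
      Nat.find_spec hne⟩⟩
  choose p hp using hp
  -- The letters that must not be used as private vertices.
  let F : Finset ι := (Finset.univ.image fun i => c i 0) ∪
    ((Finset.univ.image fun ij : Fin (m + 1) × Fin (m + 1) => c ij.1 (p ij.1 ij.2)) ∪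
      (Finset.univ.image fun ij : Fin (m + 1) × Fin (m + 1) => c ij.2 (p ij.1 ij.2)))
  have hF : F.card ≤ (m + 1) + ((m + 1) ^ 2 + (m + 1) ^ 2) := by
    refine (Finset.card_union_le _ _).trans (add_le_add ?_ ((Finset.card_union_le _ _).trans
      (add_le_add ?_ ?_))) <;> refine Finset.card_image_le.trans ?_ <;> simp [sq]
  obtain ⟨C, hCF, hC⟩ := Finset.exists_subset_card_eq (s := Fᶜ) (n := 2 * m + 2) (by
    rw [Finset.card_compl]; lia)
  let e : Fin (2 * m + 2) ≃ C := (finCongr hC.symm).trans C.equivFin.symm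
  let col : ℕ → ι := fun r => e (Fin.ofNat _ r)
  have hcolF : ∀ r, col r ∉ F := fun r => by
    exact Finset.mem_compl.1 (hCF (e (Fin.ofNat _ r)).2)
  have hcol : InjOn col (Iio (2 * m + 2)) := by
    intro r hr r' hr' h
    have := e.injective (Subtype.ext h)
    simpa [Fin.ext_iff, Nat.mod_eq_of_lt hr, Nat.mod_eq_of_lt hr'] using this
  have hidx : ∀ i : ℕ, i ≤ m → ((Fin.ofNat (m + 1) i : Fin (m + 1)) : ℕ) = i := fun i hi => by
    simp [Nat.mod_eq_of_lt (Nat.lt_succ_of_le hi)]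
  have hidx' : ∀ i ≤ m, ∀ j ≤ m, i ≠ j → Fin.ofNat (m + 1) i ≠ Fin.ofNat (m + 1) j := by
    intro i hi j hj hij h
    exact hij (by rw [← hidx i hi, h, hidx j hj])
  obtain ⟨S, hS, hSarc, hSdisj⟩ := exists_chain_addressSet (m := m)
    (c := fun i => c (Fin.ofNat _ i)) hcol
    (fun i _ r _ h => hcolF r (h ▸ by simp [F]))
    (fun i hi j hj hij => hcinj _ _ (hidx' i hi j hj hij))
    (fun i hi j hj hij => by
      obtain ⟨h1, h2⟩ := hp _ _ (hidx' i hi j hj hij)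
      refine ⟨_, h1, h2, fun r _ => ⟨fun h => hcolF r ?_, fun h => hcolF r ?_⟩⟩ <;> rw [← h]
      · exact Finset.mem_union_right _ (Finset.mem_union_left _ (Finset.mem_image.2
          ⟨(Fin.ofNat _ i, Fin.ofNat _ j), by simp, rfl⟩))
      · exact Finset.mem_union_right _ (Finset.mem_union_right _ (Finset.mem_image.2
          ⟨(Fin.ofNat _ i, Fin.ofNat _ j), by simp, rfl⟩)))
  have hxc : ∀ i, ((x i : addressSet ι) : ι → ℝ) = mass (c i) 0 := fun i => (hc i).symm
  obtain ⟨α, hα, t, ht, htx⟩ := exists_isEmbedding_of_chain hm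
    (x := fun i => x (Fin.ofNat _ i)) (S := fun i => Subtype.val ⁻¹' S i)
    (fun i hi => JoinedByArc.preimage IsEmbedding.subtypeVal
      (by rw [Subtype.range_coe]; exact hS i) (by rw [hxc, hxc]; exact hSarc i hi))
    (fun i j hij hj p hp => by
      have := hSdisj i j hij hj hp
      simpa [← hxc, Subtype.val_inj] using this)
    (fun i hi j hj h => by
      by_contra hij
      exact hidx' i hi j hj hij (hx h))
  refine ⟨α, hα, t, ht, fun i => (htx i).trans ?_⟩
  congr 1
  exact Fin.ext (hidx i i.is_le)

end Chain

/-! ### Rim-finiteness, and the trix as the set of addresses -/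

section Rim

/-- `X` has a base of open sets with finite boundary, in pointwise form. -/
def IsRimFinite (X : Type*) [TopologicalSpace X] : Prop :=
  ∀ (x : X) (U : Set X), IsOpen U → x ∈ U →
    ∃ V, IsOpen V ∧ x ∈ V ∧ V ⊆ U ∧ (frontier V).Finite

variable {X Y : Type*} [TopologicalSpace X] [TopologicalSpace Y]

theorem IsRimFinite.exists_basis (h : IsRimFinite X) :
    ∃ B : Set (Set X), TopologicalSpace.IsTopologicalBasis B ∧ ∀ U ∈ B, (frontier U).Finite := by
  refine ⟨{V | IsOpen V ∧ (frontier V).Finite},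
    TopologicalSpace.isTopologicalBasis_of_isOpen_of_nhds (fun V hV => hV.1) ?_, fun V hV => hV.2⟩
  intro x U hx hU
  obtain ⟨V, h1, h2, h3, h4⟩ := h x U hU hx
  exact ⟨V, ⟨h1, h4⟩, h2, h3⟩

theorem IsRimFinite.congr (h : IsRimFinite X) (e : X ≃ₜ Y) : IsRimFinite Y := by
  intro y U hU hy
  obtain ⟨V, h1, h2, h3, h4⟩ := h (e.symm y) (e ⁻¹' U) (hU.preimage e.continuous) (by simpa)
  refine ⟨e.symm ⁻¹' V, h1.preimage e.symm.continuous, h2, fun z hz => ?_, ?_⟩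
  · simpa using h3 hz
  · rw [← e.symm.preimage_frontier]
    exact h4.preimage e.symm.injective.injOn

end Rim

section AddressSet

variable {ι : Type*} [DecidableEq ι]

theorem continuous_mass_zero [TopologicalSpace ι] [DiscreteTopology ι] :
    Continuous fun c : ℕ → ι => mass c 0 := by
  refine continuous_pi fun l => ?_
  refine continuous_tsum (u := dyadicWeight 0) (fun j => ?_)
    (hasSum_dyadicWeight le_rfl zero_le_one).summable fun j c => ?_
  · exact (continuous_of_discreteTopology
      (f := fun a : ι => if a = l then dyadicWeight 0 j else 0)).comp (continuous_apply j)
  · have := dyadicWeight_nonneg 0 j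
    rw [Real.norm_eq_abs]
    split_ifs <;> simp [abs_of_nonneg, this]

/-- The cell of the word `w`: the points with an address that starts with `w`. -/
def cell {m : ℕ} (w : Fin m → ι) : Set (ι → ℝ) :=
  (fun c : ℕ → ι => mass c 0) '' {c | ∀ i : Fin m, c i = w i}

theorem isCompact_cell [Finite ι] {m : ℕ} (w : Fin m → ι) : IsCompact (cell w) := by
  let _ : TopologicalSpace ι := ⊥
  have : DiscreteTopology ι := ⟨rfl⟩
  refine IsCompact.image (IsClosed.isCompact ?_) continuous_mass_zero
  simp only [ofPred_forall]
  exact isClosed_iInter fun i => isClosed_eq (continuous_apply _) continuous_const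

theorem isCompact_addressSet [Finite ι] : IsCompact (addressSet ι) := by
  let _ : TopologicalSpace ι := ⊥
  have : DiscreteTopology ι := ⟨rfl⟩
  exact isCompact_range continuous_mass_zero

theorem mass_le_one (c : ℕ → ι) (l : ι) : mass c 0 l ≤ 1 := by
  have := mass_sub_le c l le_rfl zero_le_one le_rfl
  rw [mass_one] at this
  linarith

theorem dist_le_of_mem_cell [Fintype ι] {m : ℕ} {w : Fin m → ι} {p q : ι → ℝ} (hp : p ∈ cell w)
    (hq : q ∈ cell w) : dist p q ≤ 2⁻¹ ^ m := by
  obtain ⟨c, hc, rfl⟩ := hp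
  obtain ⟨c', hc', rfl⟩ := hq
  have hm := inv_two_pow_pos m
  refine (dist_pi_le_iff hm.le).2 fun l => ?_
  dsimp only
  rw [mass_zero_eq_sum_add c m, mass_zero_eq_sum_add c' m, Real.dist_eq]
  have : ∀ i ∈ Finset.range m, (if c i = l then (2⁻¹ : ℝ) ^ (i + 1) else 0) =
      if c' i = l then (2⁻¹ : ℝ) ^ (i + 1) else 0 := fun i hi => by
    have hi := Finset.mem_range.1 hi
    rw [hc ⟨i, hi⟩, hc' ⟨i, hi⟩]
  rw [Finset.sum_congr rfl this, add_sub_add_left_eq_sub, ← mul_sub, abs_mul, abs_of_pos hm]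
  refine mul_le_of_le_one_right hm.le (abs_le.2 ⟨?_, ?_⟩)
  · linarith [mass_nonneg (fun i => c (i + m)) 0 l, mass_le_one (fun i => c' (i + m)) l]
  · linarith [mass_nonneg (fun i => c' (i + m)) 0 l, mass_le_one (fun i => c (i + m)) l]

/-- A point has two addresses only if these are `w a b b b …` and `w b a a a …`. -/
theorem eq_of_mass_eq {c c' : ℕ → ι} {j : ℕ} (h : mass c 0 = mass c' 0)
    (hagree : ∀ i < j, c i = c' i) (hne : c j ≠ c' j) {i : ℕ} (hi : j < i) : c i = c' j := by
  by_contra hib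
  have hσ := inv_two_pow_pos j
  have hσ' := inv_two_pow_succ j
  have hσ1 : (2⁻¹ : ℝ) ^ j ≤ 1 := pow_le_one₀ (by norm_num) (by norm_num)
  have hij : (2⁻¹ : ℝ) ^ i ≤ 2⁻¹ ^ (j + 1) := pow_le_pow_of_le_one (by norm_num) (by norm_num) hi
  have h1 := le_mass_sub (c := c') (j := j) rfl le_rfl hσ.le hσ1
  have h2 := mass_sub_le_of_ne hne (t := 2⁻¹ ^ (j + 1)) (s := 2⁻¹ ^ j) (by positivity)
    (by linarith) hσ1
  have h3 := mass_sub_le_of_ne hib (t := 0) (s := 2⁻¹ ^ (j + 1)) le_rfl (by positivity)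
    (by linarith)
  rw [dyadicWeight_eq_zero le_rfl, dyadicWeight_zero] at h1
  rw [dyadicWeight_eq_zero (t := 2⁻¹ ^ j) le_rfl, dyadicWeight_of_le le_rfl] at h2
  rw [dyadicWeight_zero, dyadicWeight_eq_zero hij] at h3
  rw [← mass_congr hagree le_rfl, ← h] at h1
  linarith [inv_two_pow_pos (i + 1)]

variable (ι) in
/-- The points with an address that is constant from the `m`-th letter on: the vertices of the cells
of level `m`. -/
def cellVertices (m : ℕ) : Set (ι → ℝ) :=
  (fun c : ℕ → ι => mass c 0) '' {c | ∃ a, ∀ i, m ≤ i → c i = a}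

theorem finite_cellVertices [Finite ι] (m : ℕ) : (cellVertices ι m).Finite := by
  refine (Set.finite_range fun wa : (Fin m → ι) × ι =>
    mass (fun i => if h : i < m then wa.1 ⟨i, h⟩ else wa.2) 0).subset ?_
  rintro _ ⟨c, ⟨a, ha⟩, rfl⟩
  refine ⟨(fun i => c i, a), ?_⟩
  dsimp only
  congr 1
  ext i
  split_ifs with h
  · rfl
  · exact (ha i (not_lt.1 h)).symm

theorem cell_inter_subset {m : ℕ} {w w' : Fin m → ι} (h : w ≠ w') :
    cell w ∩ cell w' ⊆ cellVertices ι m := by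
  rintro _ ⟨⟨c, hc, rfl⟩, c', hc', heq⟩
  have hne : ∃ j, c j ≠ c' j := by
    by_contra! hall
    exact h (funext fun i => by rw [← hc i, ← hc' i, hall])
  have hlt : Nat.find hne < m := by
    by_contra! hle
    refine h (funext fun i => ?_)
    rw [← hc i, ← hc' i]
    exact not_not.1 (Nat.find_min hne (i.2.trans_le hle))
  exact ⟨c, ⟨_, fun i hi => eq_of_mass_eq heq.symm
    (fun q hq => not_not.1 (Nat.find_min hne hq)) (Nat.find_spec hne) (hlt.trans_le hi)⟩, rfl⟩

/-- The complement of the cells of level `m` that do not contain a given point is an open set, which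
lies in the union of the cells that do contain it, and its boundary consists of vertices of cells of
this level. -/
theorem isRimFinite_addressSet [Fintype ι] : IsRimFinite (addressSet ι) := by
  intro x U hU hx
  obtain ⟨ε, hε, hball⟩ := Metric.isOpen_iff.1 hU x hx
  obtain ⟨m, hm⟩ := exists_pow_lt_of_lt_one hε (by norm_num : (2⁻¹ : ℝ) < 1)
  let C : (Fin m → ι) → Set (addressSet ι) := fun w => Subtype.val ⁻¹' cell w
  have hC : ∀ w, IsClosed (C w) := fun w =>
    (isCompact_cell w).isClosed.preimage continuous_subtype_val
  have hcover : ∀ p : addressSet ι, ∃ w, p ∈ C w := by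
    rintro ⟨_, c, rfl⟩
    exact ⟨fun i => c i, c, fun _ => rfl, rfl⟩
  let V : Set (addressSet ι) := (⋃ w : {w // x ∉ C w}, C w)ᶜ
  let W : Set (addressSet ι) := ⋃ w : {w // x ∈ C w}, C w
  have hVo : IsOpen V := (isClosed_iUnion_of_finite fun w => hC _).isOpen_compl
  have hW : IsClosed W := isClosed_iUnion_of_finite fun w => hC _
  have hVW : V ⊆ W := by
    intro p hp
    obtain ⟨w, hw⟩ := hcover p
    refine mem_iUnion.2 ⟨⟨w, ?_⟩, hw⟩
    by_contra hxw
    exact hp (mem_iUnion.2 ⟨⟨w, hxw⟩, hw⟩)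
  refine ⟨V, hVo, ?_, fun p hp => hball ?_, ?_⟩
  · intro h
    obtain ⟨w, hw⟩ := mem_iUnion.1 h
    exact w.2 hw
  · obtain ⟨w, hw⟩ := mem_iUnion.1 (hVW hp)
    exact (dist_le_of_mem_cell hw w.2).trans_lt hm
  · refine ((finite_cellVertices (ι := ι) m).preimage Subtype.val_injective.injOn).subset ?_
    rw [hVo.frontier_eq]
    rintro p ⟨hp, hpV⟩
    obtain ⟨w, hw⟩ := mem_iUnion.1 (closure_minimal hVW hW hp)
    obtain ⟨w', hw'⟩ := mem_iUnion.1 (not_not.1 hpV)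
    have hne : (w : Fin m → ι) ≠ w' := fun h => w'.2 (by rw [← h]; exact w.2)
    exact cell_inter_subset hne ⟨hw, hw'⟩

theorem infinite_addressSet [Fintype ι] [Nontrivial ι] : Infinite (addressSet ι) := by
  obtain ⟨a, b, hab⟩ := exists_pair_ne ι
  have hinj := (joinedByArc_edge hab).choose_spec.2.1
  refine Set.infinite_coe_iff.2 (Infinite.mono ?_
    ((Icc_infinite (zero_lt_one' ℝ)).image hinj))
  rw [(joinedByArc_edge hab).choose_spec.2.2.2.2]
  rintro _ ⟨t, ht, rfl⟩
  exact edge_mem_addressSet a b ht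

end AddressSet

section Trix

variable {N : ℕ} {E : Type*} [NormedAddCommGroup E] [NormedSpace ℝ E] (v : Fin N → E)

/-- The vertices of the simplex of level `m` that belongs to the first `m` letters of `c`. -/
noncomputable def addressSimplex (c : ℕ → Fin N) (m : ℕ) (i : Fin N) : E :=
  ∑ j ∈ Finset.range m, (2⁻¹ : ℝ) ^ (j + 1) • v (c j) + (2⁻¹ : ℝ) ^ m • v i

theorem midpoint_addressSimplex (c : ℕ → Fin N) (m : ℕ) (i : Fin N) :
    midpoint ℝ (addressSimplex v c m (c m)) (addressSimplex v c m i) =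
      addressSimplex v c (m + 1) i := by
  simp only [addressSimplex, midpoint_eq_smul_add, Finset.sum_range_succ, pow_succ, invOf_eq_inv]
  module

theorem mem_trixSimplices_iff [NeZero N] {m : ℕ} {w : Fin N → E} :
    w ∈ trixSimplices v m ↔ ∃ c : ℕ → Fin N, w = addressSimplex v c m := by
  induction m generalizing w with
  | zero =>
    simp only [trixSimplices, mem_singleton_iff]
    have : ∀ c, addressSimplex v c 0 = v := fun c => by
      ext i; simp [addressSimplex]
    simp [this]
  | succ m ih =>
    simp only [trixSimplices, mem_iUnion, exists_prop, trixSubdivide, mem_range]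
    constructor
    · rintro ⟨u, hu, i, rfl⟩
      obtain ⟨c, rfl⟩ := ih.1 hu
      have hcongr : addressSimplex v c m = addressSimplex v (Function.update c m i) m := by
        ext l
        simp only [addressSimplex]
        congr 1
        refine Finset.sum_congr rfl fun j hj => ?_
        rw [Function.update_of_ne (Finset.mem_range.1 hj).ne]
      refine ⟨Function.update c m i, funext fun l => ?_⟩
      rw [← midpoint_addressSimplex, ← hcongr, Function.update_self]
    · rintro ⟨c, rfl⟩
      exact ⟨_, ih.2 ⟨c, rfl⟩, c m, funext fun l => midpoint_addressSimplex v c m l⟩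

theorem linearCombination_mass (c : ℕ → Fin N) (m : ℕ) :
    Fintype.linearCombination ℝ v (mass c 0) =
      ∑ i, mass (fun j => c (j + m)) 0 i • addressSimplex v c m i := by
  have h : mass c 0 = ∑ i ∈ Finset.range m, (2⁻¹ : ℝ) ^ (i + 1) • Pi.single (c i) (1 : ℝ) +
      (2⁻¹ : ℝ) ^ m • mass (fun j => c (j + m)) 0 := by
    ext l
    rw [mass_zero_eq_sum_add c m l]
    simp [Finset.sum_apply, Pi.single_apply, eq_comm]
  rw [h]
  simp only [map_add, map_sum, map_smul, Fintype.linearCombination_apply_single, one_smul,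
    addressSimplex, smul_add, Finset.sum_add_distrib]
  rw [← Finset.sum_smul, sum_mass _ le_rfl zero_le_one, sub_zero, one_smul,
    Fintype.linearCombination_apply, Finset.smul_sum]
  exact congrArg _ (Finset.sum_congr rfl fun i _ => smul_comm _ _ _)

theorem linearCombination_mass_mem (c : ℕ → Fin N) (m : ℕ) :
    Fintype.linearCombination ℝ v (mass c 0) ∈ convexHull ℝ (range (addressSimplex v c m)) := by
  rw [linearCombination_mass v c m]
  exact (convex_convexHull ℝ _).sum_mem (fun i _ => mass_nonneg _ _ _)
    (by rw [sum_mass _ le_rfl zero_le_one, sub_zero])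
    fun i _ => subset_convexHull ℝ _ (mem_range_self i)

theorem continuous_linearCombination : Continuous (Fintype.linearCombination ℝ v) := by
  have : (Fintype.linearCombination ℝ v : (Fin N → ℝ) → E) = fun p => ∑ i, p i • v i := by
    ext p; rw [Fintype.linearCombination_apply]
  rw [this]
  fun_prop

/-- A point common to all levels is a limit of points with addresses, since the simplices of
level `m` have diameter at most `2⁻¹ ^ m` times that of the initial simplex. -/
theorem iInter_trixLevel_eq [NeZero N] :
    ⋂ m, trixLevel v m = Fintype.linearCombination ℝ v '' addressSet (Fin N) := by
  apply Subset.antisymm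
  · intro x hx
    have hclosed : IsClosed (Fintype.linearCombination ℝ v '' addressSet (Fin N)) :=
      (isCompact_addressSet.image (continuous_linearCombination v)).isClosed
    rw [← hclosed.closure_eq, Metric.mem_closure_iff]
    intro ε hε
    set D := Metric.diam (range v)
    have hD : 0 ≤ D := Metric.diam_nonneg
    obtain ⟨m, hm⟩ := exists_pow_lt_of_lt_one (div_pos hε (by positivity : 0 < D + 1))
      (by norm_num : (2⁻¹ : ℝ) < 1)
    obtain ⟨w, hw, hxw⟩ := mem_iUnion₂.1 (mem_iInter.1 hx m)
    obtain ⟨c, rfl⟩ := (mem_trixSimplices_iff v).1 hw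
    refine ⟨_, mem_image_of_mem _ ⟨c, rfl⟩, ?_⟩
    have h1 := Metric.dist_le_diam_of_mem
      (isBounded_convexHull.2 (Set.finite_range (addressSimplex v c m)).isBounded) hxw
      (linearCombination_mass_mem v c m)
    rw [convexHull_diam] at h1
    have h2 : Metric.diam (range (addressSimplex v c m)) ≤ 2⁻¹ ^ m * D := by
      refine Metric.diam_le_of_forall_dist_le (by positivity) ?_
      rintro _ ⟨i, rfl⟩ _ ⟨j, rfl⟩
      rw [addressSimplex, addressSimplex, dist_add_left, dist_smul₀, Real.norm_of_nonneg
        (by positivity)]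
      gcongr
      exact Metric.dist_le_diam_of_mem (Set.finite_range v).isBounded (mem_range_self i)
        (mem_range_self j)
    rw [lt_div_iff₀ (by positivity)] at hm
    have := inv_two_pow_pos m
    exact (h1.trans h2).trans_lt (by nlinarith)
  · rintro _ ⟨_, ⟨c, rfl⟩, rfl⟩
    exact mem_iInter.2 fun m => mem_iUnion₂.2 ⟨_, (mem_trixSimplices_iff v).2 ⟨c, rfl⟩,
      linearCombination_mass_mem v c m⟩

theorem linearCombination_trixVertex_injOn :
    InjOn (Fintype.linearCombination ℝ (trixVertex N)) (addressSet (Fin N)) := by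
  rintro _ ⟨c, rfl⟩ _ ⟨c', rfl⟩ h
  dsimp only at h ⊢
  have hcoord : ∀ (p : Fin N → ℝ) (i : Fin N) (hi : (i : ℕ) < N - 1),
      Fintype.linearCombination ℝ (trixVertex N) p ⟨i, hi⟩ = p i := by
    intro p i hi
    simp [Fintype.linearCombination_apply, trixVertex, Fin.val_inj]
  have hlt : ∀ i : Fin N, (i : ℕ) < N - 1 → mass c 0 i = mass c' 0 i := fun i hi => by
    rw [← hcoord (mass c 0) i hi, h, hcoord]
  ext i
  by_cases hi : (i : ℕ) < N - 1
  · exact hlt i hi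
  · have h1 := sum_mass c le_rfl zero_le_one
    rw [← sum_mass c' le_rfl zero_le_one, ← Finset.add_sum_erase _ _ (Finset.mem_univ i),
      ← Finset.add_sum_erase _ _ (Finset.mem_univ i),
      Finset.sum_congr rfl fun l hl => hlt l ?_] at h1
    · exact add_right_cancel h1
    · have := Finset.ne_of_mem_erase hl
      rw [ne_eq, Fin.ext_iff] at this
      lia

/-- The trix is the set of points with addresses. -/
noncomputable def addressSetHomeomorph (N : ℕ) [NeZero N] : addressSet (Fin N) ≃ₜ NTrix N :=
  haveI : CompactSpace (addressSet (Fin N)) := isCompact_iff_compactSpace.1 isCompact_addressSet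
  ((continuous_linearCombination (trixVertex N)).continuousOn.domRestrict.subtype_mk _
    |>.homeoOfEquivCompactToT2
      (f := Equiv.Set.imageOfInjOn _ _ linearCombination_trixVertex_injOn)).trans
    (Homeomorph.setCongr (iInter_trixLevel_eq (trixVertex N)).symm)

end Trix

/-! ### Strong arc connectedness of unions -/

section Interleaving

variable {Z : Type*} {A B : Set Z}

/-- If `U` consists of common points of `A` and `B` and has at least as many points as the list
`x :: l` has changes between `A` and `B`, then inserting points of `U` makes any two consecutive
points lie together in `A` or in `B`. The changes are estimated by the number of points of the list
that do not lie in both sets. -/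
theorem exists_interleaving [DecidableEq Z] (hAB : ∀ z, z ∈ A ∨ z ∈ B)
    [DecidablePred fun z => z ∈ A ∧ z ∈ B] (l : List Z) :
    ∀ (x : Z) (U : Finset Z), (∀ u ∈ U, u ∈ A ∧ u ∈ B) → (x :: l).Nodup →
      (∀ u ∈ U, u ∉ x :: l) →
      ((x :: l).filter fun z => ¬ (z ∈ A ∧ z ∈ B)).length ≤ U.card + 1 →
      ∃ l' : List Z, (x :: l').Nodup ∧ (x :: l).Sublist (x :: l') ∧
        (x :: l').IsChain (fun u v => (u ∈ A ∧ v ∈ A) ∨ (u ∈ B ∧ v ∈ B)) ∧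
        ∀ z ∈ l', z ∈ l ∨ z ∈ U := by
  induction l with
  | nil =>
    intro x U _ _ _ _
    exact ⟨[], by simp, by simp, by simp, by simp⟩
  | cons y l ih =>
    intro x U hU hnd hdisj hcount
    by_cases h : (x ∈ A ∧ y ∈ A) ∨ (x ∈ B ∧ y ∈ B)
    · obtain ⟨l', h1, h2, h3, h4⟩ := ih y U hU hnd.tail
        (fun u hu hul => hdisj u hu (List.mem_cons_of_mem _ hul))
        (le_trans (List.Sublist.length_le ((List.sublist_cons_self x _).filter _)) hcount)
      refine ⟨y :: l', List.nodup_cons.2 ⟨fun hx => ?_, h1⟩, h2.cons_cons x,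
        List.isChain_cons_cons.2 ⟨h, h3⟩, fun z hz => ?_⟩
      · rcases List.mem_cons.1 hx with rfl | hx
        · simp at hnd
        · rcases h4 x hx with hx | hx
          · simp [hx] at hnd
          · exact hdisj x hx (by simp)
      · rcases List.mem_cons.1 hz with rfl | hz
        · simp
        · exact (h4 z hz).imp_left (List.mem_cons_of_mem _)
    · have hx : ¬ (x ∈ A ∧ x ∈ B) := by have := hAB y; tauto
      have hy : ¬ (y ∈ A ∧ y ∈ B) := by have := hAB x; tauto
      have hUne : U.Nonempty := by
        rw [← Finset.card_pos]
        simp [hx, hy] at hcount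
        lia
      obtain ⟨u, hu⟩ := hUne
      obtain ⟨l', h1, h2, h3, h4⟩ := ih y (U.erase u)
        (fun v hv => hU v (Finset.mem_of_mem_erase hv)) hnd.tail
        (fun v hv hvl => hdisj v (Finset.mem_of_mem_erase hv) (List.mem_cons_of_mem _ hvl)) (by
          have := Finset.card_erase_add_one hu
          rw [List.filter_cons_of_pos (by simpa using hx)] at hcount
          simp only [List.length_cons] at hcount
          lia)
      have hmem : ∀ z ∈ y :: l', z ∈ y :: l ∨ z ∈ U.erase u := fun z hz => by
        rcases List.mem_cons.1 hz with rfl | hz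
        · simp
        · exact (h4 z hz).imp_left (List.mem_cons_of_mem _)
      have hul : u ∉ y :: l' := fun h => (hmem u h).elim
        (fun h => hdisj u hu (List.mem_cons_of_mem _ h)) (fun h => by simp at h)
      have hxl : x ∉ u :: y :: l' := by
        intro h
        rcases List.mem_cons.1 h with rfl | h
        · exact hdisj x hu (by simp)
        · rcases hmem x h with h | h
          · exact (List.nodup_cons.1 hnd).1 h
          · exact hdisj x (Finset.mem_of_mem_erase h) (by simp)
      refine ⟨u :: y :: l', List.nodup_cons.2 ⟨hxl, List.nodup_cons.2 ⟨hul, h1⟩⟩,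
        (h2.cons u).cons_cons x, ?_, fun z hz => ?_⟩
      · have := hU u hu
        have := hAB x
        have := hAB y
        rw [List.isChain_cons_cons, List.isChain_cons_cons]
        exact ⟨by tauto, by tauto, h3⟩
      · rcases List.mem_cons.1 hz with rfl | hz
        · exact Or.inr hu
        · exact (hmem z hz).imp_right Finset.mem_of_mem_erase

/-- A list of `n` points can be enlarged, by at most `n - 1` common points of `A` and `B`, to a list
of all these points, in which any two consecutive ones lie together in `A` or in `B`. -/
theorem exists_list_through [DecidableEq Z] (hAB : ∀ z, z ∈ A ∨ z ∈ B) {G : Finset Z}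
    (hG : ∀ z, z ∈ G ↔ z ∈ A ∧ z ∈ B) {l : List Z} (hl : l.Nodup)
    (hcard : l.length = G.card + 1) :
    ∃ L : List Z, L.Nodup ∧ l.Sublist L ∧
      L.IsChain (fun u v => (u ∈ A ∧ v ∈ A) ∨ (u ∈ B ∧ v ∈ B)) ∧ (∀ z ∈ G, z ∈ L) ∧
      ∀ z ∈ L, z ∈ l ∨ z ∈ G := by
  classical
  obtain ⟨x, l, rfl⟩ : ∃ x l', l = x :: l' := List.exists_cons_of_length_eq_add_one hcard
  have hcount : ((x :: l).filter fun z => ¬ (z ∈ A ∧ z ∈ B)).length ≤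
      (G \ (x :: l).toFinset).card + 1 := by
    have h1 := List.length_eq_length_filter_add (l := x :: l) (fun z => decide (¬ (z ∈ A ∧ z ∈ B)))
    have h2 : ((x :: l).filter fun z => !decide (¬ (z ∈ A ∧ z ∈ B))).length =
        (G ∩ (x :: l).toFinset).card := by
      rw [← List.toFinset_card_of_nodup (hl.filter _)]
      congr 1
      ext z
      simp [hG, and_comm]
    have h3 := Finset.card_sdiff_add_card_inter G (x :: l).toFinset
    lia
  obtain ⟨l', h1, h2, h3, h4⟩ := exists_interleaving hAB l x (G \ (x :: l).toFinset)
    (fun u hu => (hG u).1 (Finset.mem_sdiff.1 hu).1) hl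
    (fun u hu hul => (Finset.mem_sdiff.1 hu).2 (List.mem_toFinset.2 hul)) hcount
  have hrest : ∀ z ∈ (G \ (x :: l').toFinset).toList, z ∈ G ∧ z ∉ x :: l' := fun z hz => by
    rw [Finset.mem_toList, Finset.mem_sdiff, List.mem_toFinset] at hz
    exact hz
  refine ⟨(x :: l') ++ (G \ (x :: l').toFinset).toList, ?_, h2.trans (List.sublist_append_left _ _),
    ?_, fun z hz => ?_, fun z hz => ?_⟩
  · exact h1.append (Finset.nodup_toList _) fun z hz hz' => (hrest z hz').2 hz
  · refine List.isChain_append.2 ⟨h3, ?_, fun u _ v hv => ?_⟩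
    · refine (List.pairwise_of_forall_mem_list fun u hu v _ => ?_).isChain
      have := (hG u).1 (hrest u hu).1
      have := hAB v
      tauto
    · have := (hG v).1 (hrest v (List.mem_of_mem_head? hv)).1
      have := hAB u
      tauto
  · rw [List.mem_append, Finset.mem_toList, Finset.mem_sdiff, List.mem_toFinset]
    tauto
  · rcases List.mem_append.1 hz with hz | hz
    · rcases List.mem_cons.1 hz with rfl | hz
      · simp
      · exact (h4 z hz).imp (List.mem_cons_of_mem _) fun h => (Finset.mem_sdiff.1 h).1
    · exact Or.inr (hrest z hz).1

end Interleaving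

section Pieces

variable {X Z : Type*} [TopologicalSpace X] [TopologicalSpace Z]

theorem JoinedByArc.of_isEmbedding {α : unitInterval → X} (hα : IsEmbedding α)
    {s t : unitInterval} (hst : s < t) : JoinedByArc (α s) (α t) (α '' Icc s t) := by
  have h0 : (0 : ℝ) ≤ 1 := zero_le_one
  have hsub : Icc (s : ℝ) t ⊆ Icc 0 1 := Icc_subset_Icc s.2.1 t.2.2
  have hproj : ∀ u ∈ Icc (s : ℝ) t, ((projIcc 0 1 h0 u : unitInterval) : ℝ) = u := fun u hu => by
    rw [projIcc_of_mem h0 (hsub hu)]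
  have := JoinedByArc.of_param (f := fun u => α (projIcc 0 1 h0 u)) (a := s) (b := t) hst
    (hα.continuous.comp continuous_projIcc).continuousOn (fun u hu v hv h => by
      rw [← hproj u hu, ← hproj v hv, hα.injective h])
  simp only [projIcc_val] at this
  convert this using 1
  ext p
  constructor
  · rintro ⟨u, hu, rfl⟩
    exact ⟨u, hu, congrArg α (projIcc_val h0 u)⟩
  · rintro ⟨u, hu, rfl⟩
    exact ⟨⟨u, hsub hu⟩, hu, congrArg α (projIcc_of_mem h0 (hsub hu)).symm⟩

/-- The part of a sequence of points of `Z` that lies in an embedded strongly arc connected space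
`X` lies on an arc in `X`. Its pieces between points that are consecutive in the whole sequence
meet at most in common end points, and contain no further points of the sequence. -/
theorem exists_pieces [Infinite X] {q : ℕ} (hX : IsSac q X) {φ : X → Z} (hφ : Continuous φ)
    (hφi : Function.Injective φ) {y : ℕ → Z} {J : Finset ℕ} (hJ : J.card ≤ q)
    (hJy : ∀ i ∈ J, y i ∈ range φ) (hy : InjOn y J) :
    ∃ S : ℕ → Set Z, (∀ i, S i ⊆ range φ) ∧
      (∀ i ∈ J, i + 1 ∈ J → JoinedByArc (y i) (y (i + 1)) (S i)) ∧
      (∀ i j, i < j → i + 1 ∈ J → j ∈ J → S i ∩ S j ⊆ {y (i + 1)} ∩ {y j}) ∧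
      ∀ i ∈ J, i + 1 ∈ J → ∀ r ∈ J, y r ∈ S i → r = i ∨ r = i + 1 := by
  have hp : ∀ j : J, ∃ p, φ p = y j := fun j => hJy j j.2
  choose p hp using hp
  let e := J.orderIsoOfFin rfl
  obtain ⟨α, hα, t, ht, htp⟩ := hX.mono hJ (p ∘ e) (fun i j hij => e.injective
    (Subtype.ext (hy (e i).2 (e j).2 (by rw [← hp, ← hp]; exact congrArg φ hij))))
  let τ : ℕ → unitInterval := fun i => if h : i ∈ J then t (e.symm ⟨i, h⟩) else 0
  have hτ : ∀ i ∈ J, φ (α (τ i)) = y i := by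
    intro i hi
    simp only [τ, hi, dif_pos, htp, Function.comp_apply, OrderIso.apply_symm_apply, hp]
  have hmono : StrictMonoOn τ J := by
    intro i hi j hj hij
    have hi' : i ∈ J := hi
    have hj' : j ∈ J := hj
    simp only [τ, hi', hj', dif_pos]
    exact ht (e.symm.strictMono hij)
  have hinj : Function.Injective (φ ∘ α) := hφi.comp hα.injective
  refine ⟨fun i => φ '' (α '' Icc (τ i) (τ (i + 1))), fun i => image_subset_range _ _, ?_, ?_, ?_⟩
  · intro i hi hi'
    rw [← hτ i hi, ← hτ (i + 1) hi']
    exact (JoinedByArc.of_isEmbedding hα (hmono hi hi' (Nat.lt_succ_self i))).map hφ hφi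
  · rintro i j hij hi hj _ ⟨⟨_, ⟨s, hs, rfl⟩, rfl⟩, _, ⟨u, hu, rfl⟩, heq⟩
    obtain rfl : u = s := hinj heq
    have hle : τ (i + 1) ≤ τ j := hmono.monotoneOn hi hj hij
    have h1 : u = τ (i + 1) := le_antisymm hs.2 (hle.trans hu.1)
    have h2 : u = τ j := le_antisymm (hs.2.trans hle) hu.1
    exact ⟨by rw [mem_singleton_iff, h1, hτ _ hi], by rw [mem_singleton_iff, h2, hτ _ hj]⟩
  · rintro i hi hi' r hr ⟨_, ⟨s, hs, rfl⟩, heq⟩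
    rw [← hτ r hr] at heq
    obtain rfl : s = τ r := hinj heq
    have h1 := (hmono.le_iff_le hi hr).1 hs.1
    have h2 := (hmono.le_iff_le hr hi').1 hs.2
    lia

/-- Two strongly arc connected spaces that are closed in `Z` and meet in `k` points make up
a `(k + 1)`-strongly arc connected space. -/
theorem isSac_of_union {X Y : Type*} [TopologicalSpace X] [TopologicalSpace Y] [Infinite X]
    [Infinite Y] [T2Space Z] {φ : X → Z} {ψ : Y → Z} (hφ : Continuous φ)
    (hφi : Function.Injective φ) (hψ : Continuous ψ) (hψi : Function.Injective ψ)
    (hcover : ∀ z, z ∈ range φ ∨ z ∈ range ψ) {G : Finset Z}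
    (hG : ∀ z, z ∈ G ↔ z ∈ range φ ∧ z ∈ range ψ) (hG0 : 0 < G.card)
    (hX : IsSac (2 * G.card + 1) X) (hY : IsSac (2 * G.card + 1) Y) : IsSac (G.card + 1) Z := by
  classical
  intro x hx
  obtain ⟨L, hLnd, hxL, hchain, hGL, hLx⟩ := exists_list_through hcover hG
    (l := List.ofFn x) (List.nodup_ofFn.2 hx) (by simp)
  obtain ⟨κ, hκ⟩ := List.sublist_iff_exists_fin_orderEmbedding_get_eq.1 hxL
  have hlen : G.card + 1 ≤ L.length := by simpa using hxL.length_le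
  obtain ⟨m, hm⟩ : ∃ m, L.length = m + 1 := ⟨L.length - 1, by lia⟩
  have hm0 : 0 < m := by lia
  let y : ℕ → Z := fun i => L.getD i (x 0)
  have hyL : ∀ i (hi : i < L.length), y i = L[i] := fun i hi => List.getD_eq_getElem _ _ hi
  have hyinj : InjOn y (Iic m) := by
    intro i hi j hj hij
    simp only [mem_Iic] at hi hj
    rw [hyL i (by lia), hyL j (by lia)] at hij
    exact (hLnd.getElem_inj_iff).1 hij
  have hstep : ∀ i < m, (y i ∈ range φ ∧ y (i + 1) ∈ range φ) ∨
      (y i ∈ range ψ ∧ y (i + 1) ∈ range ψ) := by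
    intro i hi
    rw [hyL i (by lia), hyL (i + 1) (by lia)]
    exact List.isChain_iff_getElem.1 hchain i (by lia)
  let J : Set Z → Finset ℕ := fun C => (Finset.range (m + 1)).filter fun i => y i ∈ C
  have hJ : ∀ {C i}, i ∈ J C ↔ i ≤ m ∧ y i ∈ C := by simp [J]
  have hJinj : ∀ C, InjOn y (J C) := fun C => hyinj.mono fun i hi => (hJ.1 hi).1
  have hJcard : ∀ C, (J C).card ≤ 2 * G.card + 1 := by
    intro C
    rw [← Finset.card_image_of_injOn (hJinj C)]
    refine (Finset.card_le_card (t := Finset.univ.image x ∪ G) fun z hz => ?_).trans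
      ((Finset.card_union_le _ _).trans ?_)
    · obtain ⟨i, hi, rfl⟩ := Finset.mem_image.1 hz
      have := hLx (y i) (by rw [hyL i (by have := (hJ.1 hi).1; lia)]; exact List.getElem_mem _)
      rw [List.mem_ofFn] at this
      simpa using this
    · have := Finset.card_image_le (s := Finset.univ) (f := x)
      simp only [Finset.card_univ, Fintype.card_fin] at this
      lia
  obtain ⟨S, hS1, hS2, hS3, hS4⟩ := exists_pieces hX hφ hφi (hJcard (range φ))
    (fun i hi => (hJ.1 hi).2) (hJinj _)
  obtain ⟨T, hT1, hT2, hT3, hT4⟩ := exists_pieces hY hψ hψi (hJcard (range ψ))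
    (fun i hi => (hJ.1 hi).2) (hJinj _)
  -- Pieces in different spaces meet in points of `G`, all of which are in the sequence `y`.
  have hST : ∀ i j, i ≠ j → i ∈ J (range φ) → i + 1 ∈ J (range φ) → j ∈ J (range ψ) →
      j + 1 ∈ J (range ψ) → ∀ p ∈ S i, p ∈ T j →
      p = y (min i j + 1) ∧ p = y (max i j) := by
    intro i j hij hi hi' hj hj' p hpS hpT
    have hpG := (hG p).2 ⟨hS1 i hpS, hT1 j hpT⟩
    obtain ⟨r, hr, hrp⟩ := List.getElem_of_mem (hGL p hpG)
    rw [← hyL r hr] at hrp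
    subst hrp
    have h1 := hS4 i hi hi' r (hJ.2 ⟨by lia, hS1 i hpS⟩) hpS
    have h2 := hT4 j hj hj' r (hJ.2 ⟨by lia, hT1 j hpT⟩) hpT
    rcases lt_or_gt_of_ne hij with h | h
    · rw [min_eq_left h.le, max_eq_right h.le]
      constructor <;> congr 1 <;> lia
    · rw [min_eq_right h.le, max_eq_left h.le]
      constructor <;> congr 1 <;> lia
  let P : ℕ → Prop := fun i => y i ∈ range φ ∧ y (i + 1) ∈ range φ
  have hP : ∀ i < m, P i → i ∈ J (range φ) ∧ i + 1 ∈ J (range φ) := fun i hi h =>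
    ⟨hJ.2 ⟨by lia, h.1⟩, hJ.2 ⟨by lia, h.2⟩⟩
  have hP' : ∀ i < m, ¬ P i → i ∈ J (range ψ) ∧ i + 1 ∈ J (range ψ) := fun i hi h =>
    ⟨hJ.2 ⟨by lia, ((hstep i hi).resolve_left h).1⟩, hJ.2 ⟨by lia, ((hstep i hi).resolve_left h).2⟩⟩
  obtain ⟨α, hα, t, ht, hty⟩ := exists_isEmbedding_of_chain hm0 (x := y)
    (S := fun i => if P i then S i else T i) (fun i hi => by
      split_ifs with h
      · exact hS2 i (hP i hi h).1 (hP i hi h).2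
      · exact hT2 i (hP' i hi h).1 (hP' i hi h).2)
    (fun i j hij hj p hp => by
      have hi := hij.trans hj
      have hmin := min_eq_left hij.le
      have hmax := max_eq_right hij.le
      by_cases h : P i <;> by_cases h' : P j <;> simp only [h, h', if_true, if_false] at hp
      · exact hS3 i j hij (hP i hi h).2 (hP j hj h').1 hp
      · have := hST i j hij.ne (hP i hi h).1 (hP i hi h).2 (hP' j hj h').1 (hP' j hj h').2 p hp.1
          hp.2
        rwa [hmin, hmax] at this
      · have := hST j i hij.ne' (hP j hj h').1 (hP j hj h').2 (hP' i hi h).1 (hP' i hi h).2 p hp.2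
          hp.1
        rwa [min_comm, hmin, max_comm, hmax] at this
      · exact hT3 i j hij (hP' i hi h).2 (hP' j hj h').1 hp)
    hyinj
  have hlen' : (List.ofFn x).length = G.card + 1 := by simp
  refine ⟨α, hα, fun i => t (finCongr hm (κ (finCongr hlen'.symm i))), fun i j hij => ht ?_,
    fun i => ?_⟩
  · exact κ.strictMono hij
  · rw [hty]
    have := hκ (finCongr hlen'.symm i)
    simp only [List.get_eq_getElem] at this
    simp only [finCongr_apply, Fin.val_cast] at this ⊢
    rw [hyL _ (Fin.is_lt _), ← this, List.getElem_ofFn]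

/-- An arc that alternates between points of two closed sets uses a different common point of these
sets at each crossing. -/
theorem not_isSac_of_union {A B : Set Z} (hA : IsClosed A) (hB : IsClosed B)
    (hcover : ∀ z, z ∈ A ∨ z ∈ B) {G : Finset Z} (hG : ∀ z, z ∈ A → z ∈ B → z ∈ G)
    (hAinf : (A \ B).Infinite) (hBinf : (B \ A).Infinite) : ¬ IsSac (G.card + 2) Z := by
  intro h
  let eA := hAinf.natEmbedding
  let eB := hBinf.natEmbedding
  let x : Fin (G.card + 2) → Z := fun i => if Even (i : ℕ) then eA i else eB i
  have hx : Function.Injective x := by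
    intro i j hij
    have hA' := fun k => (eA k).2
    have hB' := fun k => (eB k).2
    simp only [x] at hij
    split_ifs at hij with h1 h2 h2
    · exact Fin.ext (eA.injective (Subtype.ext hij))
    · exact absurd (hB' j).1 (hij ▸ (hA' i).2)
    · exact absurd (hA' j).1 (hij ▸ (hB' i).2)
    · exact Fin.ext (eB.injective (Subtype.ext hij))
  obtain ⟨α, hα, t, ht, htx⟩ := h x hx
  have hcross : ∀ i : Fin (G.card + 1), ∃ s, t i.castSucc < s ∧ s < t i.succ ∧ α s ∈ G := by
    intro i
    have hlt : t i.castSucc < t i.succ := ht i.castSucc_lt_succ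
    have hends : (x i.castSucc ∈ A \ B ∧ x i.succ ∈ B \ A) ∨
        (x i.castSucc ∈ B \ A ∧ x i.succ ∈ A \ B) := by
      by_cases hi : Even (i : ℕ)
      · left
        simp [x, hi, Nat.even_add_one]
      · right
        simp [x, hi, Nat.even_add_one]
    have hconn : IsPreconnected (α '' Icc (t i.castSucc) (t i.succ)) :=
      isPreconnected_Icc.image _ hα.continuous.continuousOn
    have hleft : x i.castSucc ∈ α '' Icc (t i.castSucc) (t i.succ) :=
      ⟨_, left_mem_Icc.2 hlt.le, htx _⟩
    have hright : x i.succ ∈ α '' Icc (t i.castSucc) (t i.succ) :=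
      ⟨_, right_mem_Icc.2 hlt.le, htx _⟩
    obtain ⟨_, ⟨s, hs, rfl⟩, hsA, hsB⟩ := isPreconnected_closed_iff.1 hconn A B hA hB
      (fun z _ => hcover z)
      (by rcases hends with h | h
          exacts [⟨_, hleft, h.1.1⟩, ⟨_, hright, h.2.1⟩])
      (by rcases hends with h | h
          exacts [⟨_, hright, h.2.1⟩, ⟨_, hleft, h.1.1⟩])
    refine ⟨s, hs.1.lt_of_ne ?_, hs.2.lt_of_ne ?_, hG _ hsA hsB⟩
    · rintro rfl
      rw [htx] at hsA hsB
      rcases hends with h | h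
      exacts [h.1.2 hsB, h.1.2 hsA]
    · rintro rfl
      rw [htx] at hsA hsB
      rcases hends with h | h
      exacts [h.2.2 hsA, h.2.2 hsB]
  choose s hs1 hs2 hs3 using hcross
  have hs : StrictMono s := by
    intro i j hij
    refine (hs2 i).trans_le (le_trans (ht.monotone ?_) (hs1 j).le)
    exact Fin.le_def.2 (by simpa using hij)
  have := Fintype.card_le_of_injective (fun i => (⟨α (s i), hs3 i⟩ : G)) fun i j hij =>
    hs.injective (hα.injective (congrArg Subtype.val hij))
  simp at this

end Pieces

/-! ### The gluing of two spaces -/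

namespace Gluing

universe u v w

section Maps

variable {k : ℕ} {X Y : Type*} (a : Fin k ↪ X) (b : Fin k ↪ Y)

/-- The map of the first space to the gluing. -/
def inl (x : X) : Gluing a b := Quot.mk _ (Sum.inl x)

/-- The map of the second space to the gluing. -/
def inr (y : Y) : Gluing a b := Quot.mk _ (Sum.inr y)

theorem inl_eq_inr (i : Fin k) : inl a b (a i) = inr a b (b i) := Quot.sound ⟨i, rfl, rfl⟩

theorem mem_range_or (z : Gluing a b) : z ∈ range (inl a b) ∨ z ∈ range (inr a b) := by
  induction z using Quot.inductionOn with
  | h p => exact p.casesOn (fun x => Or.inl ⟨x, rfl⟩) fun y => Or.inr ⟨y, rfl⟩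

variable [TopologicalSpace X] [TopologicalSpace Y]

theorem continuous_inl : Continuous (inl a b) := continuous_quot_mk.comp _root_.continuous_inl

theorem continuous_inr : Continuous (inr a b) := continuous_quot_mk.comp _root_.continuous_inr

theorem isOpen_iff {U : Set (Gluing a b)} :
    IsOpen U ↔ IsOpen (inl a b ⁻¹' U) ∧ IsOpen (inr a b ⁻¹' U) := by
  rw [← isQuotientMap_quot_mk.isOpen_preimage, isOpen_sum_iff]
  rfl

end Maps

section Metrizable

variable {k : ℕ} [NeZero k] {X Y : Type u} [MetricSpace X] [MetricSpace Y] (a : Fin k ↪ X)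
  (b : Fin k ↪ Y)

/-- Each inclusion is extended to the other space by Tietze's theorem. A third coordinate, which
is the signed distance to the set of glued points, separates the two spaces. -/
theorem exists_injective {E : Type v} {F : Type w} [TopologicalSpace E] [TopologicalSpace F]
    [TietzeExtension.{u} E] [TietzeExtension.{u} F] {φ : X → E} {ψ : Y → F} (hφ : Continuous φ)
    (hφi : Function.Injective φ) (hψ : Continuous ψ) (hψi : Function.Injective ψ) :
    ∃ Φ : Gluing a b → E × F × ℝ, Continuous Φ ∧ Function.Injective Φ ∧
      Function.Injective (inl a b) ∧ Function.Injective (inr a b) ∧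
      ∀ x y, inl a b x = inr a b y ↔ ∃ i, x = a i ∧ y = b i := by
  -- `f` and `g` extend the inclusions from the glued points to the other space.
  obtain ⟨f, hf⟩ := ContinuousMap.exists_extension'
    (continuous_of_discreteTopology.isClosedEmbedding b.injective) ⟨φ ∘ a, by fun_prop⟩
  obtain ⟨g, hg⟩ := ContinuousMap.exists_extension'
    (continuous_of_discreteTopology.isClosedEmbedding a.injective) ⟨ψ ∘ b, by fun_prop⟩
  have hf' : ∀ i, f (b i) = φ (a i) := fun i => congrFun hf i
  have hg' : ∀ i, g (a i) = ψ (b i) := fun i => congrFun hg i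
  let Φ₀ : X ⊕ Y → E × F × ℝ := Sum.elim
    (fun x => (φ x, g x, Metric.infDist x (range a)))
    (fun y => (f y, ψ y, -Metric.infDist y (range b)))
  have hΦ₀ : Continuous Φ₀ := by
    refine Continuous.sumElim ?_ ?_
    · exact hφ.prodMk (g.continuous.prodMk (Metric.continuous_infDist_pt _))
    · exact f.continuous.prodMk (hψ.prodMk (Metric.continuous_infDist_pt _).neg)
  let Φ : Gluing a b → E × F × ℝ := Quot.lift Φ₀ (by
    rintro _ _ ⟨i, rfl, rfl⟩
    simp [Φ₀, hf', hg', Metric.infDist_zero_of_mem])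
  have hΦl : ∀ x, Φ (inl a b x) = (φ x, g x, Metric.infDist x (range a)) := fun x => rfl
  have hΦr : ∀ y, Φ (inr a b y) = (f y, ψ y, -Metric.infDist y (range b)) := fun y => rfl
  have key : ∀ x y, Φ (inl a b x) = Φ (inr a b y) → ∃ i, x = a i ∧ y = b i := by
    intro x y h
    rw [hΦl, hΦr, Prod.mk.injEq, Prod.mk.injEq] at h
    obtain ⟨h1, -, h3⟩ := h
    have h4 := Metric.infDist_nonneg (x := x) (s := range a)
    have h5 := Metric.infDist_nonneg (x := y) (s := range b)
    obtain ⟨i, rfl⟩ := ((finite_range a).isClosed.mem_iff_infDist_zero (range_nonempty a)).2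
      (by linarith : Metric.infDist x (range a) = 0)
    obtain ⟨j, rfl⟩ := ((finite_range b).isClosed.mem_iff_infDist_zero (range_nonempty b)).2
      (by linarith : Metric.infDist y (range b) = 0)
    rw [hf'] at h1
    rw [a.injective (hφi h1)]
    exact ⟨j, rfl, rfl⟩
  have hl : ∀ x x', Φ (inl a b x) = Φ (inl a b x') → x = x' := fun x x' h =>
    hφi (congrArg Prod.fst h)
  have hr : ∀ y y', Φ (inr a b y) = Φ (inr a b y') → y = y' := fun y y' h =>
    hψi (congrArg (fun p => p.2.1) h)
  refine ⟨Φ, continuous_quot_lift _ hΦ₀, ?_, fun x x' h => hl _ _ (congrArg Φ h),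
    fun y y' h => hr _ _ (congrArg Φ h), fun x y => ⟨fun h => key _ _ (congrArg Φ h), ?_⟩⟩
  · intro z z' h
    rcases mem_range_or a b z with ⟨x, rfl⟩ | ⟨y, rfl⟩ <;>
    rcases mem_range_or a b z' with ⟨x', rfl⟩ | ⟨y', rfl⟩
    · rw [hl _ _ h]
    · obtain ⟨i, rfl, rfl⟩ := key _ _ h
      exact inl_eq_inr a b i
    · obtain ⟨i, rfl, rfl⟩ := key _ _ h.symm
      exact (inl_eq_inr a b i).symm
    · rw [hr _ _ h]
  · rintro ⟨i, rfl, rfl⟩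
    exact inl_eq_inr a b i

end Metrizable

section Regular

variable {k : ℕ} {X Y : Type*} [TopologicalSpace X] [TopologicalSpace Y] (a : Fin k ↪ X)
  (b : Fin k ↪ Y)

theorem connectedSpace [NeZero k] [ConnectedSpace X] [ConnectedSpace Y] :
    ConnectedSpace (Gluing a b) := by
  refine connectedSpace_iff_univ.2 ?_
  have : (univ : Set (Gluing a b)) = range (inl a b) ∪ range (inr a b) :=
    (eq_univ_of_forall fun z => mem_range_or a b z).symm
  rw [this]
  exact (isConnected_range (continuous_inl a b)).union
    ⟨inl a b (a 0), mem_range_self _, b 0, (inl_eq_inr a b 0).symm⟩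
    (isConnected_range (continuous_inr a b))

/-- The boundary of a set in the gluing comes from the boundaries of its traces in both spaces. -/
theorem finite_frontier [CompactSpace X] [CompactSpace Y] [T2Space (Gluing a b)]
    {V : Set (Gluing a b)} (hV : IsOpen V) (hl : (frontier (inl a b ⁻¹' V)).Finite)
    (hr : (frontier (inr a b ⁻¹' V)).Finite) : (frontier V).Finite := by
  refine ((hl.image (inl a b)).union (hr.image (inr a b))).subset ?_
  have hcl : IsClosed (inl a b '' closure (inl a b ⁻¹' V) ∪ inr a b '' closure (inr a b ⁻¹' V)) :=
    (isClosed_closure.isCompact.image (continuous_inl a b)).isClosed.union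
      (isClosed_closure.isCompact.image (continuous_inr a b)).isClosed
  have hsub : V ⊆ inl a b '' closure (inl a b ⁻¹' V) ∪ inr a b '' closure (inr a b ⁻¹' V) := by
    intro z hz
    rcases mem_range_or a b z with ⟨x, rfl⟩ | ⟨y, rfl⟩
    · exact Or.inl (mem_image_of_mem _ (subset_closure hz))
    · exact Or.inr (mem_image_of_mem _ (subset_closure hz))
  rw [hV.frontier_eq, (hV.preimage (continuous_inl a b)).frontier_eq,
    (hV.preimage (continuous_inr a b)).frontier_eq]
  rintro z ⟨hz, hzV⟩
  rcases closure_minimal hsub hcl hz with ⟨x, hx, rfl⟩ | ⟨y, hy, rfl⟩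
  · exact Or.inl ⟨x, ⟨hx, hzV⟩, rfl⟩
  · exact Or.inr ⟨y, ⟨hy, hzV⟩, rfl⟩

/-- Open sets with finite boundary in both spaces that contain the same glued points make up an
open set with finite boundary. -/
theorem image_union_image [CompactSpace X] [CompactSpace Y]
    [T2Space (Gluing a b)] (hinl : Function.Injective (inl a b))
    (hinr : Function.Injective (inr a b))
    (hglue : ∀ x y, inl a b x = inr a b y ↔ ∃ i, x = a i ∧ y = b i) {V : Set X} {W : Set Y}
    (hV : IsOpen V) (hW : IsOpen W) (hVf : (frontier V).Finite) (hWf : (frontier W).Finite)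
    (h : ∀ i, a i ∈ V ↔ b i ∈ W) :
    IsOpen (inl a b '' V ∪ inr a b '' W) ∧ (frontier (inl a b '' V ∪ inr a b '' W)).Finite := by
  have hl : inl a b ⁻¹' (inl a b '' V ∪ inr a b '' W) = V := by
    refine Subset.antisymm ?_ fun x hx => Or.inl ⟨x, hx, rfl⟩
    rintro x (⟨x', hx', heq⟩ | ⟨y, hy, heq⟩)
    · exact hinl heq ▸ hx'
    · obtain ⟨j, rfl, rfl⟩ := (hglue x y).1 heq.symm
      exact (h j).2 hy
  have hr : inr a b ⁻¹' (inl a b '' V ∪ inr a b '' W) = W := by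
    refine Subset.antisymm ?_ fun y hy => Or.inr ⟨y, hy, rfl⟩
    rintro y (⟨x, hx, heq⟩ | ⟨y', hy', heq⟩)
    · obtain ⟨j, rfl, rfl⟩ := (hglue x y).1 heq
      exact (h j).1 hx
    · exact hinr heq ▸ hy'
  have hop : IsOpen (inl a b '' V ∪ inr a b '' W) :=
    (isOpen_iff a b).2 ⟨by rwa [hl], by rwa [hr]⟩
  exact ⟨hop, finite_frontier a b hop (by rwa [hl]) (by rwa [hr])⟩

theorem isRimFinite [CompactSpace X] [CompactSpace Y] [T1Space X] [T1Space Y]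
    [T2Space (Gluing a b)] (hinl : Function.Injective (inl a b))
    (hinr : Function.Injective (inr a b))
    (hglue : ∀ x y, inl a b x = inr a b y ↔ ∃ i, x = a i ∧ y = b i)
    (hX : IsRimFinite X) (hY : IsRimFinite Y) : IsRimFinite (Gluing a b) := by
  have hglued : ∀ {i : Fin k} {U : Set (Gluing a b)}, IsOpen U → inl a b (a i) ∈ U →
      ∃ V, IsOpen V ∧ inl a b (a i) ∈ V ∧ V ⊆ U ∧ (frontier V).Finite := by
    intro i U hU hi
    obtain ⟨V, h1, h2, h3, h4⟩ := hX (a i) (inl a b ⁻¹' U ∩ (range a \ {a i})ᶜ)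
      ((hU.preimage (continuous_inl a b)).inter
        (finite_range a).sdiff.isClosed.isOpen_compl) ⟨hi, by simp⟩
    obtain ⟨W, k1, k2, k3, k4⟩ := hY (b i) (inr a b ⁻¹' U ∩ (range b \ {b i})ᶜ)
      ((hU.preimage (continuous_inr a b)).inter
        (finite_range b).sdiff.isClosed.isOpen_compl)
      ⟨by rw [mem_preimage, ← inl_eq_inr]; exact hi, by simp⟩
    obtain ⟨hop, hfr⟩ := image_union_image a b hinl hinr hglue h1 k1 h4 k4 fun j => by
      by_cases hji : j = i
      · subst hji
        exact ⟨fun _ => k2, fun _ => h2⟩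
      · exact ⟨fun h => absurd ⟨⟨j, rfl⟩, fun h => hji (a.injective h)⟩ (h3 h).2,
          fun h => absurd ⟨⟨j, rfl⟩, fun h => hji (b.injective h)⟩ (k3 h).2⟩
    refine ⟨_, hop, Or.inl (mem_image_of_mem _ h2), ?_, hfr⟩
    rintro _ (⟨x, hx, rfl⟩ | ⟨y, hy, rfl⟩)
    exacts [(h3 hx).1, (k3 hy).1]
  intro z U hU hz
  rcases mem_range_or a b z with ⟨x, rfl⟩ | ⟨y, rfl⟩
  · by_cases hx : x ∈ range a
    · obtain ⟨i, rfl⟩ := hx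
      exact hglued hU hz
    · obtain ⟨V, h1, h2, h3, h4⟩ := hX x (inl a b ⁻¹' U ∩ (range a)ᶜ)
        ((hU.preimage (continuous_inl a b)).inter (finite_range a).isClosed.isOpen_compl) ⟨hz, hx⟩
      obtain ⟨hop, hfr⟩ := image_union_image a b hinl hinr hglue h1 isOpen_empty h4 (by simp)
        fun j => iff_of_false (fun h => (h3 h).2 ⟨j, rfl⟩) (notMem_empty _)
      rw [image_empty, union_empty] at hop hfr
      exact ⟨_, hop, mem_image_of_mem _ h2, image_subset_iff.2 fun x hx => (h3 hx).1, hfr⟩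
  · by_cases hy : y ∈ range b
    · obtain ⟨i, rfl⟩ := hy
      rw [← inl_eq_inr] at hz ⊢
      exact hglued hU hz
    · obtain ⟨W, h1, h2, h3, h4⟩ := hY y (inr a b ⁻¹' U ∩ (range b)ᶜ)
        ((hU.preimage (continuous_inr a b)).inter (finite_range b).isClosed.isOpen_compl) ⟨hz, hy⟩
      obtain ⟨hop, hfr⟩ := image_union_image a b hinl hinr hglue isOpen_empty h1 (by simp) h4
        fun j => iff_of_false (notMem_empty _) fun h => (h3 h).2 ⟨j, rfl⟩
      rw [image_empty, empty_union] at hop hfr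
      exact ⟨_, hop, mem_image_of_mem _ h2, image_subset_iff.2 fun x hx => (h3 hx).1, hfr⟩

end Regular

end Gluing

/-! ### Two copies of the trix -/

theorem mainTheorem4 (n : ℕ) (hn : 2 ≤ n) :
    ∃ N : ℕ, 3 ≤ N ∧ IsSac (2 * n - 1) (NTrix N) ∧
      ∃ a b : Fin (n - 1) ↪ NTrix N,
        IsRegularContinuum (Gluing a b) ∧ IsSac n (Gluing a b) ∧ ¬ IsSac (n + 1) (Gluing a b) := by
  classical
  obtain ⟨k, rfl⟩ : ∃ k, n = k + 1 := ⟨n - 1, by lia⟩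
  have hk : 0 < k := by lia
  have : NeZero k := ⟨hk.ne'⟩
  -- Room for the letters to be avoided by `2 * k + 1` addresses, and for two private vertices each.
  obtain ⟨N, hN⟩ : ∃ N, N = (2 * k + 1) + 2 * (2 * k + 1) ^ 2 + (2 * (2 * k) + 2) := ⟨_, rfl⟩
  have hN3 : 3 ≤ N := by lia
  have : NeZero N := ⟨by lia⟩
  have : Nontrivial (Fin N) := Fin.nontrivial_iff_two_le.2 (by lia)
  let e := addressSetHomeomorph N
  have hsac : IsSac (2 * k + 1) (NTrix N) :=
    (isSac_addressSet (by lia) (by rw [Fintype.card_fin, hN])).congr e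
  have hrim : IsRimFinite (NTrix N) := isRimFinite_addressSet.congr e
  have : CompactSpace (addressSet (Fin N)) := isCompact_iff_compactSpace.1 isCompact_addressSet
  have : CompactSpace (NTrix N) := e.compactSpace
  have : Infinite (addressSet (Fin N)) := infinite_addressSet
  have : Infinite (NTrix N) := Infinite.of_injective e e.injective
  have : ConnectedSpace (NTrix N) := (hsac.mono (by lia)).connectedSpace
  refine ⟨N, hN3, by convert hsac using 1; lia, ?_⟩
  rw [Nat.add_sub_cancel]
  let a : Fin k ↪ NTrix N := Fin.valEmbedding.trans (Infinite.natEmbedding _)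
  have : TietzeExtension.{0} (EuclideanSpace ℝ (Fin (N - 1))) :=
    RCLike.instTietzeExtensionTVS (𝕜 := ℝ)
  obtain ⟨Φ, hΦ, hΦi, hl, hr, hglue⟩ := Gluing.exists_injective a a continuous_subtype_val
    Subtype.val_injective continuous_subtype_val Subtype.val_injective
  have : T2Space (Gluing a a) := T2Space.of_injective_continuous hΦi hΦ
  let G : Finset (Gluing a a) := Finset.univ.image fun i => Gluing.inl a a (a i)
  have hGcard : G.card = k := by
    exact (Finset.card_image_of_injective _ (hl.comp a.injective)).trans (by simp)
  have hG : ∀ z, z ∈ G ↔ z ∈ range (Gluing.inl a a) ∧ z ∈ range (Gluing.inr a a) := by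
    intro z
    simp only [G, Finset.mem_image, Finset.mem_univ, true_and]
    constructor
    · rintro ⟨i, rfl⟩
      exact ⟨mem_range_self _, a i, (Gluing.inl_eq_inr a a i).symm⟩
    · rintro ⟨⟨x, rfl⟩, y, hxy⟩
      obtain ⟨i, rfl, -⟩ := (hglue x y).1 hxy.symm
      exact ⟨i, rfl⟩
  have hcompl : (range a)ᶜ.Infinite := (finite_range a).infinite_compl
  refine ⟨a, a, ⟨inferInstance, Gluing.connectedSpace a a,
    (hΦ.isClosedEmbedding hΦi).isEmbedding.metrizableSpace,
    (Gluing.isRimFinite a a hl hr hglue hrim hrim).exists_basis⟩, ?_, ?_⟩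
  · have := isSac_of_union (Gluing.continuous_inl a a) hl (Gluing.continuous_inr a a) hr
      (Gluing.mem_range_or a a) hG (by rwa [hGcard]) (by rwa [hGcard]) (by rwa [hGcard])
    rwa [hGcard] at this
  · have := not_isSac_of_union (isCompact_range (Gluing.continuous_inl a a)).isClosed
      (isCompact_range (Gluing.continuous_inr a a)).isClosed (Gluing.mem_range_or a a)
      (fun z h1 h2 => (hG z).2 ⟨h1, h2⟩)
      ((hcompl.image hl.injOn).mono ?_) ((hcompl.image hr.injOn).mono ?_)
    · rwa [hGcard] at this
    · rintro _ ⟨x, hx, rfl⟩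
      refine ⟨mem_range_self _, ?_⟩
      rintro ⟨y, hxy⟩
      obtain ⟨i, rfl, -⟩ := (hglue x y).1 hxy.symm
      exact hx ⟨i, rfl⟩
    · rintro _ ⟨y, hy, rfl⟩
      refine ⟨mem_range_self _, ?_⟩
      rintro ⟨x, hxy⟩
      obtain ⟨i, -, rfl⟩ := (hglue x y).1 hxy
      exact hy ⟨i, rfl⟩
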